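/- Let $M$ be a finite-dimensional $C^1$ manifold without boundary, with a continuous Riemannian metric on its tangent spaces and a distance $d$ inducing its topology, and let $\Phi_t$, $t\in\mathbb R$, be a flow on $M$ such that $(t,x)\mapsto\Phi_t(x)$ is continuously differentiable. Let $X\subset M$ be a compact set that is forward invariant, $\Phi_t(X)\subset X$ for $t\ge 0$ (for instance $X=M$ if $M$ is compact). Let $\Lambda\subset X$ be a compact invariant set such that: (i) $\Lambda$ is uniformly hyperbolic: there are constants $C,\lambda>0$ and, for every $x\in\Lambda$, a splitting $T_xM=\mathbb R V(x)\oplus E^s_x\oplus E^u_x$, where $V(x)=\frac{d}{dt}\big|_{t=0}\Phi_t(x)\neq 0$, such that $D\Phi_t(x)E^{s}_x=E^{s}_{\Phi_t(x)}$ and $D\Phi_t(x)E^{u}_x=E^{u}_{\Phi_t(x)}$ for all $t\in\mathbb R$, and for all $t\ge 0$, $\|D\Phi_t(x)v\|\le Ce^{-\lambda t}\|v\|$ for $v\in E^s_x$ and $\|D\Phi_{-t}(x)v\|\le Ce^{-\lambda t}\|v\|$ for $v\in E^u_x$; (ii) $\Lambda$ is an attractor of $\Phi$ in $M$ whose basin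 contains $X$: every neighbourhood $V$ of $\Lambda$ contains a neighbourhood $U$ of $\Lambda$ with $\Phi_t(U)\subset V$ for all $t\ge0$; the forward orbit of every point of some neighbourhood of $\Lambda$ converges to $\Lambda$; and the forward orbit of every point of $X$ converges to $\Lambda$. For $K\in\{\Lambda,X\}$ and $t\ge 0$ let $\mathcal U_t^K:C(K)\to C(K)$, $g\mapsto g\circ\Phi_t|_K$, be the Koopman operator on the continuous complex-valued functions on $K$. For $x\in\Lambda$ let $W_s(x)=\{y\in X: d(\Phi_t(x),\Phi_t(y))\to0 \text{ as } t\to\infty\}$. Fix $t>0$. Then $X=\bigcup_{x\in\Lambda}W_s(x)$, and: (a) if $\psi^\Lambda\in C(\Lambda)$ is an eigenfunction of $\mathcal U_t^\Lambda$ with eigenvalue $\zeta\in\mathbb C$, then the prescription $\psi^X(y)=\psi^\Lambda(x)$ whenever $x\in\Lambda$ and $y\in W_s(x)$ gives a well-defined function $\psi^X$ on $X$, which is continuous and is an eigenfunction of $\mathcal U_t^X$ with the same eigenvalue $\zeta$; (b) the spectrum of $\mathcal U_t^\Lambda$ is contained in the spectrum of $\mathcal U_t^X$. -/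

import Mathlib

open Set Filter Topology Manifold Bundle

noncomputable section

namespace KoopmanFlow

section Metric

variable {M : Type*} [MetricSpace M]

/-- The global stable leaf `W_s(x)`: all points whose forward orbit is asymptotic to that of `x`. -/
def stableLeaf (ϕ : Flow ℝ M) (x : M) : Set M :=
  {y | Tendsto (fun t : ℝ => dist (ϕ t x) (ϕ t y)) atTop (𝓝 0)}

/-- The set of points whose forward orbit converges to the set `Λ`
(eventually enters every neighbourhood of `Λ`). -/
def basin (ϕ : Flow ℝ M) (Λ : Set M) : Set M :=
  {y | Tendsto (fun t : ℝ => ϕ t y) atTop (𝓝ˢ Λ)}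

/-- `Λ` is an attractor: a compact invariant set which is (Lyapunov) stable
and attracts all points of some neighbourhood of itself. -/
structure IsAttractor (ϕ : Flow ℝ M) (Λ : Set M) : Prop where
  isCompact : IsCompact Λ
  isInvariant : IsInvariant ϕ Λ
  stable : ∀ V ∈ 𝓝ˢ Λ, ∃ U ∈ 𝓝ˢ Λ, ∀ t : ℝ, 0 ≤ t → MapsTo (ϕ t) U V
  basin_mem : basin ϕ Λ ∈ 𝓝ˢ Λ

/-- The time-`t` map of a flow, as a continuous self-map of a forward invariant set `K`. -/
def timeMap (ϕ : Flow ℝ M) {K : Set M} (hK : IsForwardInvariant ϕ K) (t : ℝ) (ht : 0 ≤ t) :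
    C(K, K) where
  toFun := (hK ht).restrict (ϕ t) K K
  continuous_toFun := (ϕ.continuous_toFun t).restrict (hK ht)

/-- The Koopman operator `g ↦ g ∘ ϕ_t` on `C(K)`, for a forward invariant set `K` and `t ≥ 0`. -/
def koopman (ϕ : Flow ℝ M) {K : Set M} (hK : IsForwardInvariant ϕ K) (t : ℝ) (ht : 0 ≤ t) :
    C(K, ℂ) →L[ℂ] C(K, ℂ) :=
  ContinuousMap.compCLM ℂ ℂ (timeMap ϕ hK t ht)

end Metric

section Hyperbolic

variable {E : Type*} [NormedAddCommGroup E] [NormedSpace ℝ E]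
  {M : Type*} [MetricSpace M] [ChartedSpace E M]

/-- The generating vector field of a flow: the velocity at time `0` of the orbit of `x`. -/
def velocity (ϕ : Flow ℝ M) (x : M) : TangentSpace 𝓘(ℝ, E) x :=
  ϕ.map_zero_apply x ▸ mfderiv 𝓘(ℝ, ℝ) 𝓘(ℝ, E) (fun t : ℝ => ϕ t x) 0 (1 : ℝ)

/-- The derivative `Dϕ_t(x) : T_x M → T_{ϕ_t x} M` of the time-`t` map. -/
def tangentMapAt (ϕ : Flow ℝ M) (t : ℝ) (x : M) :
    TangentSpace 𝓘(ℝ, E) x →L[ℝ] TangentSpace 𝓘(ℝ, E) (ϕ t x) :=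
  mfderiv 𝓘(ℝ, E) 𝓘(ℝ, E) (ϕ t) x

/-- `Λ` is a uniformly hyperbolic set of the flow: over `Λ`, the tangent space splits as the direct
sum of the (one-dimensional) flow direction, a stable space `Es` and an unstable space `Eu`; the
latter two are invariant under the derivative of the flow, and vectors in `Es` (resp. `Eu`) decay
exponentially, uniformly on `Λ`, in forward (resp. backward) time. -/
def IsUniformlyHyperbolic [RiemannianBundle (fun x : M => TangentSpace 𝓘(ℝ, E) x)]
    (ϕ : Flow ℝ M) (Λ : Set M) : Prop :=
  ∃ (Es Eu : ∀ x : M, Submodule ℝ (TangentSpace 𝓘(ℝ, E) x)) (C lam : ℝ),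
    0 < C ∧ 0 < lam ∧ ∀ x ∈ Λ,
      velocity (E := E) ϕ x ≠ 0 ∧
      DirectSum.IsInternal ![Submodule.span ℝ {velocity (E := E) ϕ x}, Es x, Eu x] ∧
      (∀ t : ℝ, (Es x).map (tangentMapAt (E := E) ϕ t x).toLinearMap = Es (ϕ t x)) ∧
      (∀ t : ℝ, (Eu x).map (tangentMapAt (E := E) ϕ t x).toLinearMap = Eu (ϕ t x)) ∧
      (∀ t : ℝ, 0 ≤ t → ∀ v ∈ Es x, ‖tangentMapAt (E := E) ϕ t x v‖ ≤ C * Real.exp (-lam * t) * ‖v‖) ∧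
      (∀ t : ℝ, 0 ≤ t → ∀ v ∈ Eu x, ‖tangentMapAt (E := E) ϕ (-t) x v‖ ≤ C * Real.exp (-lam * t) * ‖v‖)

end Hyperbolic

end KoopmanFlow

end

/-!
The theorem follows from one dynamical fact, `hasStableShadowing`: every point near a hyperbolic
attractor `Λ` lies on the stable leaf of a nearby point of `Λ` (an asymptotic phase). The facts
about Koopman operators then need no differentiable structure.

*From stable shadowing to Koopman operators.* The orbit of a point of `X` eventually comes close to
`Λ`, so it lies on a stable leaf, and flowing back shows that the stable leaves cover `X`. On `Λ`
the Koopman operator is an isometry, so an eigenvalue is unimodular. The difference of the values of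
an eigenfunction at two points whose leaves meet is therefore unchanged in modulus along the flow,
while the orbits merge; so the extension along leaves is well defined
(`eigenfunction_eq_of_mem_stableLeaf`). It is continuous because, after a long time, nearby points
are shadowed by nearby points of `Λ` (`continuous_of_eq_on_stableLeaf`). For the spectrum,
restriction `C(X) → C(Λ)` is onto, so surjectivity of `ζ - 𝓤` passes from `X` to `Λ`; injectivity
passes to `Λ` since eigenfunctions extend (`spectrum_koopman_subset`).

*Stable shadowing.* Let the forward orbit of `y` stay close to `Λ`, and let `x₀ ∈ Λ` be close to
`y`. The backward orbit of `x₀` followed by the forward orbit of `y` is an orbit with one small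
jump. In charts, and at multiples of a large time `T`, a true orbit close to it solves a
bi-infinite recursion `v (n + 1) = F n (τ n, v n)`, in which the time shifts `τ n` are unknown as
well: they take care of the neutral direction, in which nothing is contracted. The maps `F n` are
`C¹`-close to linear maps that contract the stable space and expand the unstable space strongly,
so the contraction principle solves the recursion; as there is no error in the future, working
with weights that decay there makes `v n` and `τ n` decay too
(`exists_solution_of_approx_hyperbolic`, `IsHyperbolicSplitting.exists_shadowing`). The solution
is an orbit whose whole past is close to `Λ`; since an attractor attracts a compact neighbourhood
uniformly, such an orbit lies in `Λ` (`IsAttractor.exists_forall_mem_of_reached`). Moving along it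
by the total time shift `∑ τ n` gives the point whose stable leaf contains `y`.

The constants of the recursion are uniform because the splitting is continuous. This is not assumed:
the stable and unstable spaces are characterised by closed inequalities (`mem_stable_iff`,
`mem_unstable_iff`), so the splitting is closed in the tangent bundle, and a closed family of
splittings over a compact set has bounded and continuous projections (`exists_norm_projection_le`,
`continuousOn_projection`).
-/

namespace KoopmanFlow

/-! ### Stable leaves and the Koopman operators -/

section Koopman

variable {M : Type*} [MetricSpace M]

/-- Every point close to `Λ` lies on the stable leaf of a nearby point of `Λ`. For a hyperbolic
attractor this is `hasStableShadowing` below; everything the theorem says about Koopman operators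
follows from this property alone. -/
def HasStableShadowing (ϕ : Flow ℝ M) (Λ : Set M) : Prop :=
  ∀ ε : ℝ, 0 < ε → ∃ U ∈ 𝓝ˢ Λ, ∀ y ∈ U, ∃ x ∈ Λ, dist x y < ε ∧ y ∈ stableLeaf ϕ x

theorem flow_mem_stableLeaf {ϕ : Flow ℝ M} {x y : M} (h : y ∈ stableLeaf ϕ x) (s : ℝ) :
    ϕ s y ∈ stableLeaf ϕ (ϕ s x) := by
  have h' : Tendsto (fun t : ℝ => dist (ϕ t x) (ϕ t y)) atTop (𝓝 0) := h
  have := h'.comp (tendsto_atTop_add_const_right atTop s tendsto_id)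
  refine this.congr fun t => ?_
  simp [Flow.map_add]

theorem flow_neg_flow (ϕ : Flow ℝ M) (s : ℝ) (x : M) : ϕ (-s) (ϕ s x) = x := by
  rw [← ϕ.map_add, neg_add_cancel, ϕ.map_zero_apply]

theorem flow_flow_neg (ϕ : Flow ℝ M) (s : ℝ) (x : M) : ϕ s (ϕ (-s) x) = x := by
  rw [← ϕ.map_add, add_neg_cancel, ϕ.map_zero_apply]

theorem HasStableShadowing.exists_mem_stableLeaf {ϕ : Flow ℝ M} {Λ : Set M}
    (h : HasStableShadowing ϕ Λ) (hinv : IsInvariant ϕ Λ) {y : M} (hy : y ∈ basin ϕ Λ) :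
    ∃ x ∈ Λ, y ∈ stableLeaf ϕ x := by
  obtain ⟨U, hU, hUx⟩ := h 1 one_pos
  have hy' : Tendsto (fun t : ℝ => ϕ t y) atTop (𝓝ˢ Λ) := hy
  obtain ⟨s, hs⟩ := (hy'.eventually hU).exists
  obtain ⟨x, hx, -, hxy⟩ := hUx _ hs
  refine ⟨ϕ (-s) x, hinv _ hx, ?_⟩
  simpa [flow_neg_flow] using flow_mem_stableLeaf hxy (-s)

section Eigenfunctions

variable {ϕ : Flow ℝ M} {Λ : Set M} (hinv : IsInvariant ϕ Λ) {t : ℝ} (ht : 0 ≤ t)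
  {ζ : ℂ} {ψ : C(Λ, ℂ)}

theorem eigenfunction_iterate {K : Set M} (hK : IsForwardInvariant ϕ K) (g : K → ℂ)
    (hg : ∀ x : K, g ⟨ϕ t x, hK ht x.2⟩ = ζ * g x) (n : ℕ) (x : K) :
    g ⟨ϕ (n * t) x, hK (by positivity) x.2⟩ = ζ ^ n * g x := by
  induction n with
  | zero => simp [ϕ.map_zero_apply]
  | succ n ih =>
    have : (⟨ϕ ((n + 1 : ℕ) * t) x, hK (by positivity) x.2⟩ : K) =
        ⟨ϕ t (⟨ϕ (n * t) x, hK (by positivity) x.2⟩ : K), hK ht (hK (by positivity) x.2)⟩ := by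
      apply Subtype.ext
      simp only [← ϕ.map_add]
      congr 1
      push_cast
      ring
    rw [this, hg, ih, pow_succ]
    ring

/-- On an invariant compact set the Koopman operator is an isometry, so its eigenvalues are
unimodular. -/
theorem norm_eigenvalue_eq_one (hΛ : IsCompact Λ) (hψ0 : ψ ≠ 0)
    (hψ : ∀ x : Λ, ψ ⟨ϕ t x, hinv t x.2⟩ = ζ * ψ x) : ‖ζ‖ = 1 := by
  have : CompactSpace Λ := isCompact_iff_compactSpace.mp hΛ
  have h1 : ‖ζ • ψ‖ = ‖ψ‖ := by
    apply le_antisymm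
    · refine (ContinuousMap.norm_le _ (norm_nonneg _)).2 fun x => ?_
      rw [ContinuousMap.smul_apply, smul_eq_mul, ← hψ x]
      exact ψ.norm_coe_le_norm _
    · refine (ContinuousMap.norm_le _ (norm_nonneg _)).2 fun x => ?_
      have := hψ ⟨ϕ (-t) x, hinv _ x.2⟩
      simp only [flow_flow_neg] at this
      rw [this]
      exact (ζ • ψ).norm_coe_le_norm ⟨ϕ (-t) x, hinv _ x.2⟩
  rw [norm_smul] at h1
  exact mul_right_cancel₀ (norm_ne_zero_iff.2 hψ0) (by rw [h1, one_mul])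

include hinv in
/-- An eigenfunction on `Λ` takes the same value at any two points of `Λ` whose stable leaves
meet: transporting both points along the flow multiplies the difference of the values by a
unimodular factor, while the two orbits merge. -/
theorem eigenfunction_eq_of_mem_stableLeaf (hΛ : IsCompact Λ) (ht' : 0 < t) (hζ : ‖ζ‖ = 1)
    (hψ : ∀ x : Λ, ψ ⟨ϕ t x, hinv t x.2⟩ = ζ * ψ x) {x₁ x₂ : Λ} {y : M}
    (h₁ : y ∈ stableLeaf ϕ x₁) (h₂ : y ∈ stableLeaf ϕ x₂) : ψ x₁ = ψ x₂ := by
  have : CompactSpace Λ := isCompact_iff_compactSpace.mp hΛ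
  have huc := CompactSpace.uniformContinuous_of_continuous ψ.continuous
  rw [← sub_eq_zero, ← norm_le_zero_iff]
  refine le_of_forall_pos_le_add fun ε hε => ?_
  obtain ⟨δ, hδ, H⟩ := Metric.uniformContinuous_iff.1 huc ε hε
  have h₁' : Tendsto (fun s : ℝ => dist (ϕ s x₁) (ϕ s y)) atTop (𝓝 0) := h₁
  have h₂' : Tendsto (fun s : ℝ => dist (ϕ s x₂) (ϕ s y)) atTop (𝓝 0) := h₂
  have hsum := h₁'.add h₂'
  rw [add_zero] at hsum
  have hnt : Tendsto (fun n : ℕ => (n : ℝ) * t) atTop atTop :=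
    tendsto_natCast_atTop_atTop.atTop_mul_const ht'
  obtain ⟨n, hn⟩ := ((hsum.comp hnt).eventually (gt_mem_nhds hδ)).exists
  have hd : dist (⟨ϕ (n * t) x₁, hinv _ x₁.2⟩ : Λ) ⟨ϕ (n * t) x₂, hinv _ x₂.2⟩ < δ := by
    refine lt_of_le_of_lt ?_ hn
    rw [Subtype.dist_eq]
    exact dist_triangle_right _ _ _
  have := H hd
  rw [eigenfunction_iterate ht'.le hinv.isForwardInvariant ψ hψ n x₁,
    eigenfunction_iterate ht'.le hinv.isForwardInvariant ψ hψ n x₂, dist_eq_norm, ← mul_sub,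
    norm_mul, norm_pow, hζ, one_pow, one_mul] at this
  linarith

/-- The extension of an eigenfunction along stable leaves is continuous: up to a unimodular
factor, its values at nearby points are values of `ψ` at points of `Λ` close to their images under
a large iterate of the flow, which lies where stable shadowing is precise. -/
theorem continuous_of_eq_on_stableLeaf (hshadow : HasStableShadowing ϕ Λ) (hΛ : IsCompact Λ)
    {X : Set M} (hX : IsForwardInvariant ϕ X) (hXb : X ⊆ basin ϕ Λ) (ht' : 0 < t) (hζ : ‖ζ‖ = 1)
    {Ψ : X → ℂ} (hΨ : ∀ (x : Λ) (y : X), (y : M) ∈ stableLeaf ϕ x → Ψ y = ψ x)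
    (hΨt : ∀ y : X, Ψ ⟨ϕ t y, hX ht'.le y.2⟩ = ζ * Ψ y) : Continuous Ψ := by
  have : CompactSpace Λ := isCompact_iff_compactSpace.mp hΛ
  have huc := CompactSpace.uniformContinuous_of_continuous ψ.continuous
  rw [continuous_iff_continuousAt]
  intro y
  rw [Metric.continuousAt_iff']
  intro ε hε
  obtain ⟨δ, hδ, H⟩ := Metric.uniformContinuous_iff.1 huc ε hε
  obtain ⟨U, hU, hUx⟩ := hshadow (δ / 3) (by positivity)
  obtain ⟨V, hVo, hΛV, hVU⟩ := mem_nhdsSet_iff_exists.1 hU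
  have hnt : Tendsto (fun n : ℕ => (n : ℝ) * t) atTop atTop :=
    tendsto_natCast_atTop_atTop.atTop_mul_const ht'
  have hyb : Tendsto (fun s : ℝ => ϕ s y) atTop (𝓝ˢ Λ) := hXb y.2
  obtain ⟨n, hn⟩ := ((hyb.comp hnt).eventually (hVo.mem_nhdsSet.2 hΛV)).exists
  have hcont : Continuous fun z : X => ϕ (n * t) z := by fun_prop
  have e1 : ∀ᶠ z : X in 𝓝 y, ϕ (n * t) z ∈ V :=
    hcont.continuousAt.eventually (hVo.mem_nhds hn)
  have e2 := Metric.continuousAt_iff'.1 (hcont.continuousAt (x := y)) (δ / 3) (by positivity)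
  filter_upwards [e1, e2] with z hz1 hz2
  obtain ⟨x₁, hx₁, hd₁, hl₁⟩ := hUx _ (hVU hz1)
  obtain ⟨x₂, hx₂, hd₂, hl₂⟩ := hUx _ (hVU hn)
  have hd : dist (⟨x₁, hx₁⟩ : Λ) ⟨x₂, hx₂⟩ < δ := by
    rw [Subtype.dist_eq]
    have := dist_triangle4 x₁ (ϕ (n * t) z) (ϕ (n * t) y) x₂
    have h3 := dist_comm x₂ (ϕ (n * t) y)
    simp only [Function.comp_apply] at hd₂
    linarith
  have hlt := H hd
  have g1 := hΨ ⟨x₁, hx₁⟩ ⟨ϕ (n * t) z, hX (by positivity) z.2⟩ hl₁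
  have g2 := hΨ ⟨x₂, hx₂⟩ ⟨ϕ (n * t) y, hX (by positivity) y.2⟩ hl₂
  rw [eigenfunction_iterate ht'.le hX Ψ hΨt n] at g1 g2
  rw [← g1, ← g2, dist_eq_norm, ← mul_sub, norm_mul, norm_pow, hζ, one_pow, one_mul] at hlt
  rwa [dist_eq_norm]

theorem exists_eigenvector_extension (hshadow : HasStableShadowing ϕ Λ) (hΛ : IsCompact Λ)
    {X : Set M} (hX : IsForwardInvariant ϕ X) (hΛX : Λ ⊆ X) (hXb : X ⊆ basin ϕ Λ) (ht' : 0 < t)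
    (h : Module.End.HasEigenvector
      (koopman ϕ hinv.isForwardInvariant t ht'.le).toLinearMap ζ ψ) :
    ∃ ψX : C(X, ℂ),
      (∀ (x : Λ) (y : X), (y : M) ∈ stableLeaf ϕ (x : M) → ψX y = ψ x) ∧
      Module.End.HasEigenvector (koopman ϕ hX t ht'.le).toLinearMap ζ ψX := by
  have hψ : ∀ x : Λ, ψ ⟨ϕ t x, hinv t x.2⟩ = ζ * ψ x := fun x =>
    congrArg (fun g : C(Λ, ℂ) => g x) h.apply_eq_smul
  have hζ := norm_eigenvalue_eq_one hinv hΛ h.2 hψ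
  have hex : ∀ y : X, ∃ x : Λ, (y : M) ∈ stableLeaf ϕ (x : M) := fun y => by
    obtain ⟨x, hx, hxy⟩ := hshadow.exists_mem_stableLeaf hinv (hXb y.2)
    exact ⟨⟨x, hx⟩, hxy⟩
  choose p hp using hex
  have hval : ∀ (x : Λ) (y : X), (y : M) ∈ stableLeaf ϕ (x : M) → ψ (p y) = ψ x := fun x y hxy =>
    eigenfunction_eq_of_mem_stableLeaf hinv hΛ ht' hζ hψ (hp y) hxy
  have heig : ∀ y : X, ψ (p ⟨ϕ t y, hX ht'.le y.2⟩) = ζ * ψ (p y) := fun y => by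
    rw [← hψ]
    exact hval _ _ (flow_mem_stableLeaf (hp y) t)
  have hcont : Continuous fun y : X => ψ (p y) :=
    continuous_of_eq_on_stableLeaf hshadow hΛ hX hXb ht' hζ hval heig
  refine ⟨⟨_, hcont⟩, hval, Module.End.hasEigenvector_iff.2 ⟨?_, ?_⟩⟩
  · rw [Module.End.mem_eigenspace_iff]
    ext y
    exact heig y
  · intro h0
    apply h.2
    ext x
    have hself : (x : M) ∈ stableLeaf ϕ (x : M) := by simp [stableLeaf]
    have := congrArg (fun g : C(X, ℂ) => g ⟨x, hΛX x.2⟩) h0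
    rw [← hval x ⟨x, hΛX x.2⟩ hself]
    exact this

/-- If every eigenvalue of the Koopman operator on `Λ` is one on `X`, the spectrum on `Λ` is
contained in that on `X`: restriction `C(X) → C(Λ)` is onto by Tietze, so surjectivity of
`ζ - 𝓤` passes from `X` to `Λ`, and injectivity can only fail at an eigenvalue. -/
theorem spectrum_koopman_subset (hΛ : IsCompact Λ) {X : Set M} (hXc : IsCompact X)
    (hX : IsForwardInvariant ϕ X) (hΛX : Λ ⊆ X)
    (heig : ∀ (ζ : ℂ) (ψ : C(Λ, ℂ)),
      Module.End.HasEigenvector (koopman ϕ hinv.isForwardInvariant t ht).toLinearMap ζ ψ →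
      ∃ ψX : C(X, ℂ), Module.End.HasEigenvector (koopman ϕ hX t ht).toLinearMap ζ ψX) :
    spectrum ℂ (koopman ϕ hinv.isForwardInvariant t ht) ⊆ spectrum ℂ (koopman ϕ hX t ht) := by
  have : CompactSpace Λ := isCompact_iff_compactSpace.mp hΛ
  have : CompactSpace X := isCompact_iff_compactSpace.mp hXc
  intro ζ hζ
  contrapose! hζ
  rw [spectrum.mem_iff, not_not] at hζ ⊢
  rw [ContinuousLinearMap.isUnit_iff_bijective] at hζ ⊢
  constructor
  · refine (injective_iff_map_eq_zero _).2 fun ψ h0 => ?_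
    by_contra hne
    obtain ⟨ψX, hψX⟩ := heig ζ ψ (Module.End.hasEigenvector_iff.2 ⟨by
      rw [Module.End.mem_eigenspace_iff]
      simp only [sub_apply, sub_eq_zero] at h0
      exact h0.symm, hne⟩)
    refine hψX.2 (hζ.1 ?_)
    rw [_root_.map_zero, sub_apply, sub_eq_zero]
    exact hψX.apply_eq_smul.symm
  · intro g
    have hcl : IsClosedEmbedding (Set.inclusion hΛX) :=
      (continuous_inclusion hΛX).isClosedEmbedding (inclusion_injective hΛX)
    obtain ⟨G, hG⟩ := ContinuousMap.exists_extension hcl g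
    obtain ⟨f, hf⟩ := hζ.2 G
    refine ⟨f.comp ⟨Set.inclusion hΛX, continuous_inclusion hΛX⟩, ?_⟩
    ext x
    have := congrArg (fun g : C(X, ℂ) => g (Set.inclusion hΛX x)) hf
    have hGx := congrArg (fun g : C(Λ, ℂ) => g x) hG
    exact this.trans hGx

end Eigenfunctions

end Koopman

/-! ### Solving an approximately hyperbolic recursion -/

section Recursion

variable {E : Type*} [NormedAddCommGroup E] [NormedSpace ℝ E] [CompleteSpace E]

open BoundedContinuousFunction in
/-- A bi-infinite recursion `v (n + 1) = F n (τ n, v n)`, in which the times `τ n` are unknowns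
too, has a solution near `0` if each `F n` is close to a linear map `D n` for which the equation
`v (n + 1) - D n (τ n, v n) = g n` is solved, up to a small error, by
`v n = P n (g (n - 1)) - B n (g n)` and `τ n = - c n (g n)`. In the application `P` is the
projection on the stable space, `B` the inverse of the dynamics on the unstable space, and `c` the
coordinate along the flow. The weights `ρ` record the decay that the solution inherits from the
errors `F n 0`.

The unknown of the fixed point problem is the sequence `g`, in the weighted sup norm. -/
theorem exists_solution_of_approx_hyperbolic
    {F : ℤ → ℝ × E → E} {D : ℤ → ℝ × E →L[ℝ] E} {P B : ℤ → E →L[ℝ] E} {c : ℤ → E →L[ℝ] ℝ}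
    {ρ : ℤ → ℝ} {K r η δ : ℝ} (hρ0 : ∀ n, 0 < ρ n) (hρ1 : ∀ n, ρ n ≤ 1)
    (hρm : ∀ n, ρ (n + 1) ≤ ρ n) (hρ2 : ∀ n, ρ n ≤ 2 * ρ (n + 1)) (hK : 1 ≤ K)
    (hP : ∀ n g, ‖P n g‖ ≤ K * ‖g‖) (hc : ∀ n g, ‖c n g‖ ≤ K * ‖g‖)
    (hB : ∀ n g, ‖B n g‖ ≤ 1 / 16 * ‖g‖) (hDP : ∀ n g, ‖D n (0, P n g)‖ ≤ 1 / 16 * ‖g‖)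
    (hone : ∀ n g, ‖g - P (n + 1) g - D n (c n g, B n g)‖ ≤ 1 / 16 * ‖g‖)
    (hF : ∀ n x y, ‖x‖ ≤ r → ‖y‖ ≤ r → ‖F n x - F n y - D n (x - y)‖ ≤ η * ‖x - y‖)
    (hη : η * (12 * K) ≤ 1) (hη0 : 0 ≤ η) (hF0 : ∀ n, ‖F n 0‖ ≤ δ * ρ n) (hδ : 0 ≤ δ)
    (hδr : 6 * K * δ ≤ r) :
    ∃ x : ℤ → ℝ × E, (∀ n, ‖x n‖ ≤ 6 * K * δ * ρ n) ∧ ∀ n, F n (x n) = (x (n + 1)).2 := by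
  -- the linear operator sending `g` to `(τ, v)`
  let R : (ℤ → E) → ℤ → ℝ × E := fun g n => (- c n (g n), P n (g (n - 1)) - B n (g n))
  have hRsub : ∀ g g' n, R g n - R g' n = R (g - g') n := fun g g' n => by
    simp only [R, Pi.sub_apply, map_sub, Prod.mk_sub_mk, Prod.mk.injEq]
    constructor <;> abel
  have hRbd : ∀ (g : ℤ → E) (b : ℝ), 0 ≤ b → (∀ n, ‖g n‖ ≤ b * ρ n) →
      ∀ n, ‖R g n‖ ≤ 3 * K * b * ρ n := by
    intro g b hb hg n
    have h0 := hρ0 n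
    have h1 : ‖g (n - 1)‖ ≤ b * (2 * ρ n) := by
      refine (hg _).trans (mul_le_mul_of_nonneg_left ?_ hb)
      simpa using hρ2 (n - 1)
    have h2 := hg n
    refine (Prod.norm_mk _ _).trans_le (max_le ?_ ?_)
    · rw [norm_neg]
      calc ‖c n (g n)‖ ≤ K * ‖g n‖ := hc _ _
        _ ≤ K * (b * ρ n) := by gcongr
        _ ≤ 3 * K * b * ρ n := by nlinarith [show 0 ≤ K * (b * ρ n) by positivity]
    · calc ‖P n (g (n - 1)) - B n (g n)‖ ≤ ‖P n (g (n - 1))‖ + ‖B n (g n)‖ := norm_sub_le _ _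
        _ ≤ K * ‖g (n - 1)‖ + 1 / 16 * ‖g n‖ := add_le_add (hP _ _) (hB _ _)
        _ ≤ K * (b * (2 * ρ n)) + K * (b * ρ n) := by
            gcongr
            linarith
        _ = 3 * K * b * ρ n := by ring
  -- a fixed point `g` of `Θ` is one for which `(τ, v)` solves the recursion exactly
  let Θ : (ℤ → E) → ℤ → E := fun g n => g n - (R g (n + 1)).2 + F n (R g n)
  -- `Θ` is a contraction in the weighted norm
  have hΘ : ∀ (g g' : ℤ → E) (b : ℝ), 0 ≤ b → (∀ n, ‖g n‖ ≤ 2 * δ * ρ n) →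
      (∀ n, ‖g' n‖ ≤ 2 * δ * ρ n) → (∀ n, ‖g n - g' n‖ ≤ b * ρ n) →
      ∀ n, ‖Θ g n - Θ g' n‖ ≤ 1 / 2 * b * ρ n := by
    intro g g' b hb hg hg' hgg n
    set h : ℤ → E := g - g' with hh
    have hhb : ∀ n, ‖h n‖ ≤ b * ρ n := hgg
    have hr : ∀ f : ℤ → E, (∀ n, ‖f n‖ ≤ 2 * δ * ρ n) → ‖R f n‖ ≤ r := fun f hf =>
      ((hRbd f (2 * δ) (by positivity) hf n).trans (by
        calc 3 * K * (2 * δ) * ρ n ≤ 3 * K * (2 * δ) * 1 := by gcongr; exact hρ1 n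
          _ = 6 * K * δ := by ring)).trans hδr
    have hN := hF n _ _ (hr g hg) (hr g' hg')
    rw [hRsub] at hN
    have hN' : ‖F n (R g n) - F n (R g' n) - D n (R h n)‖ ≤ 1 / 4 * (b * ρ n) := by
      refine hN.trans ((mul_le_mul_of_nonneg_left (hRbd h b hb hhb n) hη0).trans ?_)
      have : 0 ≤ b * ρ n := mul_nonneg hb (hρ0 n).le
      nlinarith
    have hsplit : D n (R h n) = D n (0, P n (h (n - 1))) - D n (c n (h n), B n (h n)) := by
      rw [← map_sub]
      simp [R]
    have key : Θ g n - Θ g' n = (h n - P (n + 1) (h n) - D n (c n (h n), B n (h n)))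
        + B (n + 1) (h (n + 1)) + D n (0, P n (h (n - 1)))
        + (F n (R g n) - F n (R g' n) - D n (R h n)) := by
      have := congrArg Prod.snd (hRsub g g' (n + 1))
      simp only [Prod.snd_sub] at this
      have e2 : (R h (n + 1)).2 = P (n + 1) (h n) - B (n + 1) (h (n + 1)) := by simp [R]
      rw [hsplit]
      calc Θ g n - Θ g' n = (g n - g' n) - ((R g (n + 1)).2 - (R g' (n + 1)).2)
            + (F n (R g n) - F n (R g' n)) := by simp only [Θ]; abel
        _ = h n - (P (n + 1) (h n) - B (n + 1) (h (n + 1)))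
            + (F n (R g n) - F n (R g' n)) := by rw [this, ← hh, e2]; rfl
        _ = _ := by abel
    rw [key]
    have t1 := hone n (h n)
    have t2 := hB (n + 1) (h (n + 1))
    have t3 := hDP n (h (n - 1))
    have u1 := hhb n
    have u2 : ‖h (n + 1)‖ ≤ b * ρ n := (hhb _).trans (mul_le_mul_of_nonneg_left (hρm n) hb)
    have u3 : ‖h (n - 1)‖ ≤ b * (2 * ρ n) :=
      (hhb _).trans (mul_le_mul_of_nonneg_left (by simpa using hρ2 (n - 1)) hb)
    have v1 := norm_add_le ((h n - P (n + 1) (h n) - D n (c n (h n), B n (h n)))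
        + B (n + 1) (h (n + 1)) + D n (0, P n (h (n - 1))))
        (F n (R g n) - F n (R g' n) - D n (R h n))
    have v2 := norm_add₃_le (a := h n - P (n + 1) (h n) - D n (c n (h n), B n (h n)))
        (b := B (n + 1) (h (n + 1))) (c := D n (0, P n (h (n - 1))))
    nlinarith
  have hΘ0 : ∀ n, ‖Θ 0 n‖ ≤ δ * ρ n := fun n => by
    have : Θ 0 n = F n 0 := by simp [Θ, R, Prod.mk_zero_zero]
    rw [this]
    exact hF0 n
  have hΘb : ∀ g : ℤ → E, (∀ n, ‖g n‖ ≤ 2 * δ * ρ n) → ∀ n, ‖Θ g n‖ ≤ 2 * δ * ρ n := by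
    intro g hg n
    have h0 : ∀ n, ‖(0 : ℤ → E) n‖ ≤ 2 * δ * ρ n := fun n => by
      have := hρ0 n
      simp only [Pi.zero_apply, norm_zero]
      positivity
    have := hΘ g 0 (2 * δ) (by positivity) hg h0 (by simpa using hg) n
    have := norm_sub_norm_le (Θ g n) (Θ 0 n)
    linarith [hΘ0 n]
  -- pass to the unweighted space of bounded sequences
  let W : (ℤ → E) → ℤ → E := fun u n => ρ n • u n
  have hW : ∀ u n b, ‖u n‖ ≤ b → ‖W u n‖ ≤ b * ρ n := fun u n b h => by
    rw [norm_smul, Real.norm_of_nonneg (hρ0 n).le, mul_comm]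
    exact mul_le_mul_of_nonneg_right h (hρ0 n).le
  have hW' : ∀ (w : E) n b, ‖w‖ ≤ b * ρ n → ‖(ρ n)⁻¹ • w‖ ≤ b := fun w n b h => by
    rw [norm_smul, norm_inv, Real.norm_of_nonneg (hρ0 n).le, inv_mul_le_iff₀ (hρ0 n), mul_comm]
    exact h
  have hmem : ∀ (u : Metric.closedBall (0 : ℤ →ᵇ E) (2 * δ)) n, ‖(u : ℤ →ᵇ E) n‖ ≤ 2 * δ :=
    fun u n => ((u : ℤ →ᵇ E).norm_coe_le_norm n).trans (mem_closedBall_zero_iff.1 u.2)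
  have hex : ∀ u : Metric.closedBall (0 : ℤ →ᵇ E) (2 * δ),
      ∃ u' : Metric.closedBall (0 : ℤ →ᵇ E) (2 * δ),
        ∀ n, (u' : ℤ →ᵇ E) n = (ρ n)⁻¹ • Θ (W (u : ℤ →ᵇ E)) n := by
    intro u
    have hbd : ∀ n, ‖(ρ n)⁻¹ • Θ (W (u : ℤ →ᵇ E)) n‖ ≤ 2 * δ := fun n =>
      hW' _ _ _ (hΘb _ (fun n => hW _ _ _ (hmem u n)) n)
    refine ⟨⟨ofNormedAddCommGroupDiscrete _ _ hbd, ?_⟩, fun n => rfl⟩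
    rw [mem_closedBall_zero_iff]
    exact norm_ofNormedAddCommGroup_le _ (by positivity) hbd
  choose Ψ hΨ using hex
  have hcontr : ContractingWith (1 / 2) Ψ := by
    refine ⟨by rw [← NNReal.coe_lt_coe]; norm_num, LipschitzWith.of_dist_le_mul fun u u' => ?_⟩
    rw [Subtype.dist_eq, Subtype.dist_eq, BoundedContinuousFunction.dist_le (by positivity)]
    intro n
    rw [hΨ, hΨ, dist_eq_norm, ← smul_sub]
    refine (hW' _ n (1 / 2 * dist (u : ℤ →ᵇ E) u') ?_).trans (by simp)
    refine hΘ _ _ _ dist_nonneg (fun n => hW _ _ _ (hmem u n)) (fun n => hW _ _ _ (hmem u' n)) ?_ n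
    intro n
    have : W (u : ℤ →ᵇ E) n - W (u' : ℤ →ᵇ E) n = W ((u : ℤ →ᵇ E) - (u' : ℤ →ᵇ E)) n := by
      simp [W, smul_sub]
    rw [this]
    refine hW _ _ _ ?_
    rw [Pi.sub_apply, ← dist_eq_norm]
    exact BoundedContinuousFunction.dist_coe_le_dist _
  have : CompleteSpace (Metric.closedBall (0 : ℤ →ᵇ E) (2 * δ)) :=
    Metric.isClosed_closedBall.completeSpace_coe
  have : Nonempty (Metric.closedBall (0 : ℤ →ᵇ E) (2 * δ)) :=
    ⟨⟨0, Metric.mem_closedBall_self (by positivity)⟩⟩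
  set u := hcontr.fixedPoint
  have hu : Ψ u = u := hcontr.fixedPoint_isFixedPt
  have hfix : ∀ n, Θ (W (u : ℤ →ᵇ E)) n = W (u : ℤ →ᵇ E) n := fun n => by
    have := hΨ u n
    rw [hu] at this
    simp only [W] at this ⊢
    rw [this, smul_inv_smul₀ (hρ0 n).ne']
  refine ⟨R (W (u : ℤ →ᵇ E)), fun n => ?_, fun n => ?_⟩
  · refine (hRbd _ (2 * δ) (by positivity) (fun n => hW _ _ _ (hmem u n)) n).trans_eq ?_
    ring
  · have := hfix n
    simp only [Θ] at this
    rw [sub_add_eq_add_sub, sub_eq_iff_eq_add] at this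
    exact add_left_cancel this

end Recursion

/-! ### Uniformity near compact sets -/

section Uniformity

theorem exists_forall_dist_lt_of_isCompact {Y Z : Type*} [PseudoMetricSpace Y]
    [PseudoMetricSpace Z] {f : Y → Z} {K : Set Y} (hK : IsCompact K)
    (hf : ∀ k ∈ K, ContinuousAt f k) {ε : ℝ} (hε : 0 < ε) :
    ∃ δ > 0, ∀ k ∈ K, ∀ x, dist x k < δ → dist (f x) (f k) < ε := by
  have := hK.uniformContinuousAt_of_continuousAt f hf (Metric.dist_mem_uniformity hε)
  obtain ⟨δ, hδ, H⟩ := Metric.mem_uniformity_dist.1 this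
  refine ⟨δ, hδ, fun k hk x hx => ?_⟩
  rw [dist_comm] at hx ⊢
  exact H hx hk

theorem exists_ball_subset_of_isCompact {Y : Type*} [PseudoMetricSpace Y] {K D : Set Y}
    (hK : IsCompact K) (hD : IsOpen D) (hKD : K ⊆ D) :
    ∃ δ > 0, ∀ k ∈ K, ∀ x, dist x k < δ → x ∈ D := by
  obtain ⟨δ, hδ, H⟩ := hK.exists_thickening_subset_open hD hKD
  exact ⟨δ, hδ, fun k hk x hx => H (Metric.mem_thickening_iff.2 ⟨k, hk, hx⟩)⟩

/-- A `C¹` map is strictly differentiable uniformly along a compact set. -/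
theorem exists_forall_norm_sub_fderiv_le_of_isCompact {G H : Type*} [NormedAddCommGroup G]
    [NormedSpace ℝ G] [NormedAddCommGroup H] [NormedSpace ℝ H] {f : G → H} {D K : Set G}
    (hD : IsOpen D) (hf : ContDiffOn ℝ 1 f D) (hK : IsCompact K) (hKD : K ⊆ D) {η : ℝ}
    (hη : 0 < η) :
    ∃ r > 0, ∀ k ∈ K, ∀ x y, dist x k < r → dist y k < r →
      x ∈ D ∧ ‖f x - f y - fderiv ℝ f k (x - y)‖ ≤ η * ‖x - y‖ := by
  have hc : ContinuousOn (fderiv ℝ f) D := hf.continuousOn_fderiv_of_isOpen hD le_rfl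
  obtain ⟨r₁, hr₁, H₁⟩ := exists_ball_subset_of_isCompact hK hD hKD
  obtain ⟨r₂, hr₂, H₂⟩ := exists_forall_dist_lt_of_isCompact hK
    (fun k hk => hc.continuousAt (hD.mem_nhds (hKD hk))) hη
  refine ⟨min r₁ r₂, lt_min hr₁ hr₂, fun k hk x y hx hy => ?_⟩
  refine ⟨H₁ k hk x (hx.trans_le (min_le_left _ _)), ?_⟩
  refine (convex_ball k (min r₁ r₂)).norm_image_sub_le_of_norm_hasFDerivWithin_le'
    (f' := fderiv ℝ f) (fun z hz => ?_) (fun z hz => ?_) (Metric.mem_ball.2 hy)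
    (Metric.mem_ball.2 hx)
  · have hzD := H₁ k hk z ((Metric.mem_ball.1 hz).trans_le (min_le_left _ _))
    exact ((hf.differentiableOn one_ne_zero).differentiableAt
      (hD.mem_nhds hzD)).hasFDerivAt.hasFDerivWithinAt
  · rw [← dist_eq_norm]
    exact (H₂ k hk z ((Metric.mem_ball.1 hz).trans_le (min_le_right _ _))).le

end Uniformity

/-! ### Families of splittings -/

section Splitting

/-- An internal direct sum of submodules has linear projections. -/
theorem exists_projections_of_isInternal {V : Type*} [AddCommGroup V] [Module ℝ V]
    {ι : Type*} [Fintype ι] [DecidableEq ι] {A : ι → Submodule ℝ V}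
    (h : DirectSum.IsInternal A) :
    (∃ p : ι → V →ₗ[ℝ] V, (∀ i v, p i v ∈ A i) ∧ ∀ v, ∑ i, p i v = v) ∧
      ∀ s : ι → V, (∀ i, s i ∈ A i) → ∑ i, s i = 0 → s = 0 := by
  let g : (∀ i, A i) ≃ₗ[ℝ] V :=
    (DirectSum.linearEquivFunOnFintype ℝ ι (fun i => A i)).symm.trans
      (LinearEquiv.ofBijective (DirectSum.coeLinearMap A) h)
  have hg : ∀ x, g x = ∑ i, (x i : V) := fun x => by
    have hx : x = ∑ i, Pi.single i (x i) := (Finset.univ_sum_single x).symm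
    conv_lhs => rw [hx]
    rw [map_sum]
    refine Finset.sum_congr rfl fun i _ => ?_
    simp only [g, LinearEquiv.trans_apply, DirectSum.linearEquivFunOnFintype_symm_single]
    exact DirectSum.coeLinearMap_of A i (x i)
  refine ⟨⟨fun i => (A i).subtype ∘ₗ LinearMap.proj i ∘ₗ g.symm.toLinearMap, fun i v => ?_,
    fun v => ?_⟩, fun s hs h0 => ?_⟩
  · exact (g.symm v i).2
  · exact (hg _).symm.trans (g.apply_symm_apply v)
  · have : g (fun i => ⟨s i, hs i⟩) = 0 := by rw [hg]; exact h0
    rw [LinearEquiv.map_eq_zero_iff] at this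
    funext i
    exact congrArg Subtype.val (congrFun this i)

variable {Y : Type*} [MetricSpace Y] {E : Type*} [NormedAddCommGroup E] [NormedSpace ℝ E]
  [FiniteDimensional ℝ E] {ι : Type*} [Fintype ι] {K : Set Y} {S : ι → Y → Submodule ℝ E}
  {P : ι → Y → E →L[ℝ] E}

omit [FiniteDimensional ℝ E] [Fintype ι] in
theorem isClosed_setOf_forall_mem
    (hS : ∀ i, IsClosed {p : Y × E | p.1 ∈ K ∧ p.2 ∈ S i p.1}) :
    IsClosed {p : Y × (ι → E) | ∀ i, p.1 ∈ K ∧ p.2 i ∈ S i p.1} := by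
  rw [ofPred_forall]
  refine isClosed_iInter fun i => ?_
  exact (hS i).preimage (f := fun p : Y × (ι → E) => (p.1, p.2 i)) (by fun_prop)

/-- The angles between the summands of a closed family of splittings over a compact set are
bounded below. -/
theorem exists_norm_projection_le (hK : IsCompact K)
    (hS : ∀ i, IsClosed {p : Y × E | p.1 ∈ K ∧ p.2 ∈ S i p.1})
    (hind : ∀ q ∈ K, ∀ s : ι → E, (∀ i, s i ∈ S i q) → ∑ i, s i = 0 → s = 0)
    (hP : ∀ q ∈ K, ∀ i v, P i q v ∈ S i q) (hsum : ∀ q ∈ K, ∀ v, ∑ i, P i q v = v) :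
    ∃ C > 0, ∀ q ∈ K, ∀ i v, ‖P i q v‖ ≤ C * ‖v‖ := by
  let Z : Set (Y × (ι → E)) := (K ×ˢ Metric.sphere 0 1) ∩ {p | ∀ i, p.1 ∈ K ∧ p.2 i ∈ S i p.1}
  have hZ : IsCompact Z :=
    (hK.prod (isCompact_sphere _ _)).inter_right (isClosed_setOf_forall_mem hS)
  have hpos : ∃ m > 0, ∀ p ∈ Z, m ≤ ‖∑ i, p.2 i‖ := by
    rcases Z.eq_empty_or_nonempty with h0 | hne
    · exact ⟨1, one_pos, by simp [h0]⟩
    obtain ⟨p, hp, hmin⟩ := hZ.exists_isMinOn hne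
      (f := fun p : Y × (ι → E) => ‖∑ i, p.2 i‖) (by fun_prop)
    refine ⟨_, norm_pos_iff.2 fun h => ?_, fun p' hp' => hmin hp'⟩
    have h1 : p.2 = 0 := hind p.1 hp.1.1 p.2 (fun i => (hp.2 i).2) h
    have h2 : ‖p.2‖ = 1 := by simpa using hp.1.2
    rw [h1, norm_zero] at h2
    exact zero_ne_one h2
  obtain ⟨m, hm, H⟩ := hpos
  refine ⟨m⁻¹, inv_pos.2 hm, fun q hq i v => ?_⟩
  let s : ι → E := fun i => P i q v
  refine (norm_le_pi_norm s i).trans ?_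
  rcases eq_or_ne s 0 with h0 | h0
  · rw [h0, norm_zero]
    positivity
  have hs : 0 < ‖s‖ := norm_pos_iff.2 h0
  have := H (q, ‖s‖⁻¹ • s) ⟨⟨hq, by simp [norm_smul, hs.ne']⟩,
    fun i => ⟨hq, Submodule.smul_mem _ _ (hP q hq i v)⟩⟩
  simp only [Pi.smul_apply, ← Finset.smul_sum, norm_smul, norm_inv, norm_norm] at this
  have hsv : ∑ i, s i = v := hsum q hq v
  rw [hsv, inv_mul_eq_div, le_div_iff₀ hs] at this
  rwa [inv_mul_eq_div, le_div_iff₀ hm, mul_comm]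

/-- The projections of a closed family of splittings over a compact set are continuous: their
graphs are closed, and they take values in compact sets. -/
theorem continuousOn_projection (hK : IsCompact K)
    (hS : ∀ i, IsClosed {p : Y × E | p.1 ∈ K ∧ p.2 ∈ S i p.1})
    (hind : ∀ q ∈ K, ∀ s : ι → E, (∀ i, s i ∈ S i q) → ∑ i, s i = 0 → s = 0)
    (hP : ∀ q ∈ K, ∀ i v, P i q v ∈ S i q) (hsum : ∀ q ∈ K, ∀ v, ∑ i, P i q v = v) (i : ι) :
    ContinuousOn (P i) K := by
  obtain ⟨C, hC, hbd⟩ := exists_norm_projection_le hK hS hind hP hsum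
  refine continuousOn_clm_apply.2 fun v => ?_
  have hpi : ContinuousOn (fun q => fun i => P i q v) K := by
    intro q hq
    refine (isCompact_closedBall (0 : ι → E) (C * ‖v‖)).tendsto_nhds_of_unique_mapClusterPt
      (l := 𝓝[K] q) ?_ ?_
    · filter_upwards [self_mem_nhdsWithin] with q' hq'
      rw [mem_closedBall_zero_iff, pi_norm_le_iff_of_nonneg (by positivity)]
      exact fun i => hbd q' hq' i v
    · intro s _ hs
      have hcl : IsClosed ({p : Y × (ι → E) | ∀ i, p.1 ∈ K ∧ p.2 i ∈ S i p.1} ∩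
          {p | ∑ i, p.2 i = v}) :=
        (isClosed_setOf_forall_mem hS).inter (isClosed_eq (by fun_prop) continuous_const)
      obtain ⟨u, hus, hu⟩ := hs.exists_seq_tendsto
      have hmem := hcl.mem_of_tendsto
        ((hu.mono_right nhdsWithin_le_nhds).prodMk_nhds hus) (by
          filter_upwards [hu.eventually self_mem_nhdsWithin] with n hn
          exact ⟨fun i => ⟨hn, hP _ hn i v⟩, hsum _ hn v⟩)
      have h0 := hind q hq (fun i => s i - P i q v)
        (fun i => Submodule.sub_mem _ (hmem.1 i).2 (hP q hq i v))
        (by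
          have h2 : ∑ i, s i = v := hmem.2
          rw [Finset.sum_sub_distrib, h2, hsum q hq, sub_self])
      funext i
      exact sub_eq_zero.1 (congrFun h0 i)
  exact continuousOn_pi.1 hpi i

end Splitting

/-! ### Tangent vectors in charts -/

section Coordinates

variable {E : Type*} [NormedAddCommGroup E] [NormedSpace ℝ E]
  {M : Type*} [MetricSpace M] [ChartedSpace E M] [IsManifold 𝓘(ℝ, E) 1 M]

/-- The tangent vector at `q` with coordinates `v` in the chart centred at `a`. -/
noncomputable def chartVec (a q : M) : E →L[ℝ] TangentSpace 𝓘(ℝ, E) q :=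
  (trivializationAt E (TangentSpace 𝓘(ℝ, E)) a).symmL ℝ q

/-- The coordinates, in the chart centred at `a`, of a tangent vector at `q`. -/
noncomputable def chartCoord (a q : M) : TangentSpace 𝓘(ℝ, E) q →L[ℝ] E :=
  (trivializationAt E (TangentSpace 𝓘(ℝ, E)) a).continuousLinearMapAt ℝ q

theorem chartCoord_chartVec {a q : M} (hq : q ∈ (chartAt E a).source) (v : E) :
    chartCoord a q (chartVec a q v) = v :=
  (trivializationAt E (TangentSpace 𝓘(ℝ, E)) a).continuousLinearMapAt_symmL hq v

theorem chartVec_chartCoord {a q : M} (hq : q ∈ (chartAt E a).source)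
    (w : TangentSpace 𝓘(ℝ, E) q) : chartVec a q (chartCoord a q w) = w :=
  (trivializationAt E (TangentSpace 𝓘(ℝ, E)) a).symmL_continuousLinearMapAt hq w

theorem continuousOn_chartVec (a : M) :
    ContinuousOn (fun p : M × E => (⟨p.1, chartVec a p.1 p.2⟩ : TangentBundle 𝓘(ℝ, E) M))
      ((chartAt E a).source ×ˢ univ) := by
  refine ((trivializationAt E (TangentSpace 𝓘(ℝ, E)) a).continuousOn_symm).congr ?_
  intro p hp
  simp only [chartVec]
  rw [Trivialization.symmL_apply _ hp.1]

theorem chartCoord_eq_mfderiv {a q : M} (hq : q ∈ (chartAt E a).source) :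
    chartCoord (E := E) a q = mfderiv 𝓘(ℝ, E) 𝓘(ℝ, E) (extChartAt 𝓘(ℝ, E) a) q :=
  TangentBundle.continuousLinearMapAt_trivializationAt hq

theorem chartVec_eq_mfderiv {a q : M} (hq : q ∈ (chartAt E a).source) :
    chartVec (E := E) a q = mfderiv 𝓘(ℝ, E) 𝓘(ℝ, E) (extChartAt 𝓘(ℝ, E) a).symm
      (extChartAt 𝓘(ℝ, E) a q) := by
  have := TangentBundle.symmL_trivializationAt (I := 𝓘(ℝ, E)) hq
  rw [modelWithCornersSelf_coe, range_id, mfderivWithin_univ] at this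
  exact this

theorem hasMFDerivAt_extChartAt_chartCoord {a q : M} (hq : q ∈ (chartAt E a).source) :
    HasMFDerivAt 𝓘(ℝ, E) 𝓘(ℝ, E) (extChartAt 𝓘(ℝ, E) a) q (chartCoord (E := E) a q) := by
  rw [chartCoord_eq_mfderiv hq]
  exact (mdifferentiableAt_extChartAt hq).hasMFDerivAt

/-- The derivative in charts of a differentiable map. -/
theorem hasFDerivAt_chart_comp {f : M → M} {a b q : M} (hq : q ∈ (chartAt E a).source)
    (hb : f q ∈ (chartAt E b).source) (hf : MDifferentiableAt 𝓘(ℝ, E) 𝓘(ℝ, E) f q) :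
    HasFDerivAt (fun v => extChartAt 𝓘(ℝ, E) b (f ((extChartAt 𝓘(ℝ, E) a).symm v)))
      (chartCoord b (f q) ∘L mfderiv 𝓘(ℝ, E) 𝓘(ℝ, E) f q ∘L chartVec a q)
      (extChartAt 𝓘(ℝ, E) a q) := by
  have hq' : q ∈ (extChartAt 𝓘(ℝ, E) a).source := by rwa [extChartAt_source]
  have h1 : HasMFDerivAt 𝓘(ℝ, E) 𝓘(ℝ, E) (extChartAt 𝓘(ℝ, E) a).symm
      (extChartAt 𝓘(ℝ, E) a q) (mfderiv 𝓘(ℝ, E) 𝓘(ℝ, E) (extChartAt 𝓘(ℝ, E) a).symm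
      (extChartAt 𝓘(ℝ, E) a q)) := by
    have := mdifferentiableWithinAt_extChartAt_symm (I := 𝓘(ℝ, E))
      ((extChartAt 𝓘(ℝ, E) a).map_source hq')
    rw [modelWithCornersSelf_coe, range_id, mdifferentiableWithinAt_univ] at this
    exact this.hasMFDerivAt
  have hinv := (extChartAt 𝓘(ℝ, E) a).left_inv hq'
  have h2 : HasMFDerivAt 𝓘(ℝ, E) 𝓘(ℝ, E) (extChartAt 𝓘(ℝ, E) b ∘ f) q
      (chartCoord (E := E) b (f q) ∘L mfderiv 𝓘(ℝ, E) 𝓘(ℝ, E) f q) :=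
    (hasMFDerivAt_extChartAt_chartCoord hb).comp q hf.hasMFDerivAt
  rw [← chartVec_eq_mfderiv hq] at h1
  have h2' : HasMFDerivAt 𝓘(ℝ, E) 𝓘(ℝ, E) (extChartAt 𝓘(ℝ, E) b ∘ f)
      ((extChartAt 𝓘(ℝ, E) a).symm (extChartAt 𝓘(ℝ, E) a q))
      (chartCoord (E := E) b (f q) ∘L mfderiv 𝓘(ℝ, E) 𝓘(ℝ, E) f q) := by
    rw [hinv]
    exact h2
  exact (h2'.comp _ h1).hasFDerivAt

end Coordinates

/-! ### The flow in charts -/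

section FlowInCharts

variable {E : Type*} [NormedAddCommGroup E] [NormedSpace ℝ E]
  {M : Type*} [MetricSpace M] [ChartedSpace E M] [IsManifold 𝓘(ℝ, E) 1 M] {ϕ : Flow ℝ M}

omit [IsManifold 𝓘(ℝ, E) 1 M] in
theorem contMDiff_flow
    (hϕ : ContMDiff (𝓘(ℝ, ℝ).prod 𝓘(ℝ, E)) 𝓘(ℝ, E) 1 (fun p : ℝ × M => ϕ p.1 p.2)) (t : ℝ) :
    ContMDiff 𝓘(ℝ, E) 𝓘(ℝ, E) 1 (ϕ t) :=
  hϕ.comp (contMDiff_const.prodMk contMDiff_id)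

omit [IsManifold 𝓘(ℝ, E) 1 M] in
theorem contMDiff_orbit
    (hϕ : ContMDiff (𝓘(ℝ, ℝ).prod 𝓘(ℝ, E)) 𝓘(ℝ, E) 1 (fun p : ℝ × M => ϕ p.1 p.2)) (x : M) :
    ContMDiff 𝓘(ℝ, ℝ) 𝓘(ℝ, E) 1 (fun t => ϕ t x) :=
  hϕ.comp (contMDiff_id.prodMk contMDiff_const)

/-- The derivative at time `0` of a differentiable function along an orbit, read in a chart. -/
theorem hasDerivAt_chart_orbit
    (hϕ : ContMDiff (𝓘(ℝ, ℝ).prod 𝓘(ℝ, E)) 𝓘(ℝ, E) 1 (fun p : ℝ × M => ϕ p.1 p.2))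
    {f : M → M} {b q : M} (hb : f q ∈ (chartAt E b).source)
    (hf : MDifferentiableAt 𝓘(ℝ, E) 𝓘(ℝ, E) f q) :
    HasDerivAt (fun τ : ℝ => extChartAt 𝓘(ℝ, E) b (f (ϕ τ q)))
      (chartCoord (E := E) b (f q) (mfderiv 𝓘(ℝ, E) 𝓘(ℝ, E) f q (velocity (E := E) ϕ q))) 0 := by
  -- `velocity` transports a vector at `ϕ 0 q` to `q`, along the equality of the two points
  have hcast : ∀ (y : M) (h : y = q) (w : TangentSpace 𝓘(ℝ, E) y),
      chartCoord (E := E) b (f y) (mfderiv 𝓘(ℝ, E) 𝓘(ℝ, E) f y w) =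
        chartCoord (E := E) b (f q)
          (mfderiv 𝓘(ℝ, E) 𝓘(ℝ, E) f q (h ▸ w : TangentSpace 𝓘(ℝ, E) q)) := by
    intro y h w
    subst h
    rfl
  rw [velocity, ← hcast (ϕ 0 q) (ϕ.map_zero_apply q)]
  have h0 := ϕ.map_zero_apply q
  have h1 : HasMFDerivAt 𝓘(ℝ, ℝ) 𝓘(ℝ, E) (fun t : ℝ => ϕ t q) 0 _ :=
    ((contMDiff_orbit hϕ q).mdifferentiable one_ne_zero 0).hasMFDerivAt
  have h2 : HasMFDerivAt 𝓘(ℝ, E) 𝓘(ℝ, E) f (ϕ 0 q) (mfderiv 𝓘(ℝ, E) 𝓘(ℝ, E) f (ϕ 0 q)) := by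
    rw [← h0] at hf
    exact hf.hasMFDerivAt
  have h3 := hasMFDerivAt_extChartAt_chartCoord (E := E) (a := b) (q := f (ϕ 0 q)) (by rwa [h0])
  have h4 : HasFDerivAt (fun τ : ℝ => extChartAt 𝓘(ℝ, E) b (f (ϕ τ q)))
      (chartCoord (E := E) b (f (ϕ 0 q)) ∘L mfderiv 𝓘(ℝ, E) 𝓘(ℝ, E) f (ϕ 0 q) ∘L
        mfderiv 𝓘(ℝ, ℝ) 𝓘(ℝ, E) (fun t : ℝ => ϕ t q) 0 : ℝ →L[ℝ] E) (0 : ℝ) :=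
    (h3.comp (0 : ℝ) (h2.comp (0 : ℝ) h1)).hasFDerivAt
  exact h4.hasDerivAt

theorem chartCoord_injective {a q : M} (hq : q ∈ (chartAt E a).source) :
    Function.Injective (chartCoord (E := E) a q) :=
  Function.LeftInverse.injective (chartVec_chartCoord hq)

theorem hasDerivAt_chart_orbit_velocity
    (hϕ : ContMDiff (𝓘(ℝ, ℝ).prod 𝓘(ℝ, E)) 𝓘(ℝ, E) 1 (fun p : ℝ × M => ϕ p.1 p.2))
    {b q : M} (hb : q ∈ (chartAt E b).source) :
    HasDerivAt (fun τ : ℝ => extChartAt 𝓘(ℝ, E) b (ϕ τ q))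
      (chartCoord (E := E) b q (velocity (E := E) ϕ q)) 0 := by
  have := hasDerivAt_chart_orbit hϕ (f := id) (b := b) hb mdifferentiableAt_id
  rw [mfderiv_id] at this
  exact this

/-- The generating vector field is invariant under the flow. -/
theorem tangentMapAt_velocity
    (hϕ : ContMDiff (𝓘(ℝ, ℝ).prod 𝓘(ℝ, E)) 𝓘(ℝ, E) 1 (fun p : ℝ × M => ϕ p.1 p.2)) (t : ℝ) (q : M) :
    tangentMapAt (E := E) ϕ t q (velocity ϕ q) = velocity ϕ (ϕ t q) := by
  have hs := mem_chart_source E (ϕ t q)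
  have h1 := hasDerivAt_chart_orbit hϕ hs ((contMDiff_flow hϕ t).mdifferentiable one_ne_zero q)
  have h2 := hasDerivAt_chart_orbit_velocity hϕ hs
  have : (fun τ : ℝ => extChartAt 𝓘(ℝ, E) (ϕ t q) (ϕ t (ϕ τ q))) =
      fun τ : ℝ => extChartAt 𝓘(ℝ, E) (ϕ t q) (ϕ τ (ϕ t q)) := by
    funext τ
    rw [← ϕ.map_add, ← ϕ.map_add, add_comm]
  rw [this] at h1
  exact chartCoord_injective hs (h1.unique h2)

/-- The time-`(T + τ)` map of the flow read in the charts centred at `a` and `b`, as a function of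
`τ` and of the coordinates of the initial point. -/
noncomputable def chartFlow (E : Type*) [NormedAddCommGroup E] [NormedSpace ℝ E]
    {M : Type*} [MetricSpace M] [ChartedSpace E M] (ϕ : Flow ℝ M) (T : ℝ) (a b : M) (p : ℝ × E) :
    E :=
  extChartAt 𝓘(ℝ, E) b (ϕ (T + p.1) ((extChartAt 𝓘(ℝ, E) a).symm p.2))

/-- The open set on which `chartFlow` is meaningful. -/
def chartFlowDomain (E : Type*) [NormedAddCommGroup E] [NormedSpace ℝ E]
    {M : Type*} [MetricSpace M] [ChartedSpace E M] (ϕ : Flow ℝ M) (T : ℝ) (a b : M) :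
    Set (ℝ × E) :=
  {p | p.2 ∈ (extChartAt 𝓘(ℝ, E) a).target} ∩
    (fun p : ℝ × E => ϕ (T + p.1) ((extChartAt 𝓘(ℝ, E) a).symm p.2)) ⁻¹' (chartAt E b).source

omit [IsManifold 𝓘(ℝ, E) 1 M] in
theorem isOpen_chartFlowDomain (T : ℝ) (a b : M) : IsOpen (chartFlowDomain E ϕ T a b) := by
  refine ContinuousOn.isOpen_inter_preimage ?_ ?_ (chartAt E b).open_source
  · refine ϕ.cont'.comp_continuousOn (ContinuousOn.prodMk (by fun_prop) ?_)
    exact (continuousOn_extChartAt_symm a).comp continuousOn_snd fun p hp => hp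
  · exact (isOpen_extChartAt_target a).preimage continuous_snd

theorem contDiffOn_chartFlow
    (hϕ : ContMDiff (𝓘(ℝ, ℝ).prod 𝓘(ℝ, E)) 𝓘(ℝ, E) 1 (fun p : ℝ × M => ϕ p.1 p.2))
    (T : ℝ) (a b : M) : ContDiffOn ℝ 1 (chartFlow E ϕ T a b) (chartFlowDomain E ϕ T a b) := by
  rw [← contMDiffOn_iff_contDiffOn]
  have h1 : ContMDiffOn 𝓘(ℝ, ℝ × E) 𝓘(ℝ, ℝ) 1 (fun p : ℝ × E => T + p.1)
      (chartFlowDomain E ϕ T a b) :=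
    (contDiff_const.add contDiff_fst).contMDiff.contMDiffOn
  have h2 : ContMDiffOn 𝓘(ℝ, ℝ × E) 𝓘(ℝ, E) 1
      (fun p : ℝ × E => (extChartAt 𝓘(ℝ, E) a).symm p.2) (chartFlowDomain E ϕ T a b) :=
    (contMDiffOn_extChartAt_symm a).comp contDiff_snd.contMDiff.contMDiffOn fun p hp => hp.1
  have h3 : ContMDiffOn 𝓘(ℝ, E) 𝓘(ℝ, E) 1 (extChartAt 𝓘(ℝ, E) b) (chartAt E b).source :=
    contMDiffOn_extChartAt
  exact h3.comp (hϕ.comp_contMDiffOn (h1.prodMk h2)) fun p hp => hp.2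

omit [IsManifold 𝓘(ℝ, E) 1 M] in
theorem mem_chartFlowDomain {T : ℝ} {a b q : M} (hq : q ∈ (chartAt E a).source)
    (hb : ϕ T q ∈ (chartAt E b).source) :
    ((0 : ℝ), extChartAt 𝓘(ℝ, E) a q) ∈ chartFlowDomain E ϕ T a b := by
  have hq' : q ∈ (extChartAt 𝓘(ℝ, E) a).source := by rwa [extChartAt_source]
  refine ⟨(extChartAt 𝓘(ℝ, E) a).map_source hq', ?_⟩
  simpa only [mem_preimage, add_zero, (extChartAt 𝓘(ℝ, E) a).left_inv hq'] using hb

/-- The derivative of `chartFlow` combines the derivative of the time-`T` map and the velocity. -/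
theorem fderiv_chartFlow
    (hϕ : ContMDiff (𝓘(ℝ, ℝ).prod 𝓘(ℝ, E)) 𝓘(ℝ, E) 1 (fun p : ℝ × M => ϕ p.1 p.2))
    {T : ℝ} {a b q : M} (hq : q ∈ (chartAt E a).source) (hb : ϕ T q ∈ (chartAt E b).source)
    (τ : ℝ) (v : E) :
    fderiv ℝ (chartFlow E ϕ T a b) (0, extChartAt 𝓘(ℝ, E) a q) (τ, v) =
      chartCoord (E := E) b (ϕ T q) (tangentMapAt (E := E) ϕ T q (chartVec a q v)) +
        τ • chartCoord (E := E) b (ϕ T q) (velocity (E := E) ϕ (ϕ T q)) := by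
  have hq' : q ∈ (extChartAt 𝓘(ℝ, E) a).source := by rwa [extChartAt_source]
  have hinv := (extChartAt 𝓘(ℝ, E) a).left_inv hq'
  have hmem := mem_chartFlowDomain hq hb
  have hd : HasFDerivAt (chartFlow E ϕ T a b) _ (0, extChartAt 𝓘(ℝ, E) a q) :=
    (((contDiffOn_chartFlow hϕ T a b).differentiableOn one_ne_zero).differentiableAt
      ((isOpen_chartFlowDomain T a b).mem_nhds hmem)).hasFDerivAt
  have hv : fderiv ℝ (chartFlow E ϕ T a b) (0, extChartAt 𝓘(ℝ, E) a q) (0, v) =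
      chartCoord (E := E) b (ϕ T q) (tangentMapAt (E := E) ϕ T q (chartVec a q v)) := by
    have h1 := hasFDerivAt_chart_comp hq hb
      ((contMDiff_flow hϕ T).mdifferentiable one_ne_zero q)
    have h2 := hd.comp (extChartAt 𝓘(ℝ, E) a q) (hasFDerivAt_prodMk_right (0 : ℝ) _)
    have h3 : chartFlow E ϕ T a b ∘ (fun w : E => ((0 : ℝ), w)) =
        fun v => extChartAt 𝓘(ℝ, E) b (ϕ T ((extChartAt 𝓘(ℝ, E) a).symm v)) := by
      funext w
      simp [chartFlow]
    rw [h3] at h2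
    exact congrArg (fun L : E →L[ℝ] E => L v) (h2.unique h1)
  have hτ : fderiv ℝ (chartFlow E ϕ T a b) (0, extChartAt 𝓘(ℝ, E) a q) (1, 0) =
      chartCoord (E := E) b (ϕ T q) (velocity (E := E) ϕ (ϕ T q)) := by
    have h1 := hasDerivAt_chart_orbit_velocity hϕ hb
    have h2 := (HasFDerivAt.comp (f := fun τ : ℝ => (τ, extChartAt 𝓘(ℝ, E) a q)) (0 : ℝ) hd
      (hasFDerivAt_prodMk_left (0 : ℝ) _)).hasDerivAt
    have h3 : chartFlow E ϕ T a b ∘ (fun τ : ℝ => (τ, extChartAt 𝓘(ℝ, E) a q)) =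
        fun τ => extChartAt 𝓘(ℝ, E) b (ϕ τ (ϕ T q)) := by
      funext τ
      simp only [chartFlow, Function.comp_apply, hinv, ← ϕ.map_add, add_comm]
    rw [h3] at h2
    exact h2.unique h1
  have hsplit : ((τ, v) : ℝ × E) = (0, v) + τ • (1, 0) := by simp
  rw [hsplit, map_add, map_smul, hv, hτ]

/-- The generating vector field is a continuous section of the tangent bundle. -/
theorem continuous_velocity
    (hϕ : ContMDiff (𝓘(ℝ, ℝ).prod 𝓘(ℝ, E)) 𝓘(ℝ, E) 1 (fun p : ℝ × M => ϕ p.1 p.2)) :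
    Continuous (fun q : M => (⟨q, velocity ϕ q⟩ : TangentBundle 𝓘(ℝ, E) M)) := by
  rw [continuous_iff_continuousAt]
  intro a
  have hso : (chartAt E a).source ∈ 𝓝 a :=
    (chartAt E a).open_source.mem_nhds (mem_chart_source E a)
  have hc : ContinuousOn (fun q : M => chartCoord (E := E) a q (velocity (E := E) ϕ q))
      (chartAt E a).source := by
    have h1 := (contDiffOn_chartFlow hϕ 0 a a).continuousOn_fderiv_of_isOpen
      (isOpen_chartFlowDomain 0 a a) le_rfl
    have h2 : ContinuousOn (fun q : M => ((0 : ℝ), extChartAt 𝓘(ℝ, E) a q))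
        (chartAt E a).source := by
      have := continuousOn_extChartAt (I := 𝓘(ℝ, E)) a
      rw [extChartAt_source] at this
      exact continuousOn_const.prodMk this
    have h3 := (h1.comp h2 fun q hq => mem_chartFlowDomain hq
      (by rwa [ϕ.map_zero_apply])).clm_apply (continuousOn_const (c := ((1 : ℝ), (0 : E))))
    refine h3.congr fun q hq => ?_
    have := fderiv_chartFlow hϕ (T := 0) hq (by rwa [ϕ.map_zero_apply]) 1 0
    rw [_root_.map_zero, _root_.map_zero, _root_.map_zero, zero_add, one_smul,
      ϕ.map_zero_apply] at this
    exact this.symm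
  have h4 := ((continuousOn_chartVec (E := E) a).comp (continuousOn_id.prodMk hc)
    fun q hq => ⟨hq, mem_univ _⟩).continuousAt hso
  refine h4.congr ?_
  filter_upwards [hso] with q hq
  simp only [Function.comp_apply, id]
  rw [chartVec_chartCoord hq]

end FlowInCharts

/-! ### Continuity of the hyperbolic splitting -/

section HyperbolicSplitting

theorem le_zero_of_forall_le_mul_exp {a k lam : ℝ} (hlam : 0 < lam)
    (h : ∀ t : ℝ, 0 ≤ t → a ≤ k * Real.exp (-lam * t)) : a ≤ 0 := by
  have h1 : Tendsto (fun t : ℝ => k * Real.exp (-lam * t)) atTop (𝓝 (k * 0)) := by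
    refine (Real.tendsto_exp_atBot.comp ?_).const_mul k
    exact tendsto_id.const_mul_atTop_of_neg (by linarith)
  rw [mul_zero] at h1
  refine ge_of_tendsto h1 ?_
  filter_upwards [eventually_ge_atTop 0] with t ht using h t ht

/-- A vector that contracts exponentially has no neutral component `c • X` and no expanding
component `g`. -/
theorem eq_zero_of_exponential_decay {V : Type*} [NormedAddCommGroup V] [NormedSpace ℝ V]
    {W : ℝ → Type*} [∀ t, NormedAddCommGroup (W t)] [∀ t, NormedSpace ℝ (W t)]
    (D : ∀ t, V →ₗ[ℝ] W t) {C lam m m' c : ℝ} {v f g X : V} (hC : 0 < C) (hlam : 0 < lam)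
    (hm : 0 < m) (hX : ∀ t, 0 ≤ t → m ≤ ‖D t X‖ ∧ ‖D t X‖ ≤ m')
    (hv : ∀ t, 0 ≤ t → ‖D t v‖ ≤ C * Real.exp (-lam * t) * ‖v‖)
    (hf : ∀ t, 0 ≤ t → ‖D t f‖ ≤ C * Real.exp (-lam * t) * ‖f‖)
    (hg : ∀ t, 0 ≤ t → ‖g‖ ≤ C * Real.exp (-lam * t) * ‖D t g‖)
    (hsum : c • X + f + g = v) : c = 0 ∧ g = 0 := by
  have hw : ∀ t, 0 ≤ t → ‖c • D t X + D t g‖ ≤ (C * (‖v‖ + ‖f‖)) * Real.exp (-lam * t) := by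
    intro t ht
    have : c • D t X + D t g = D t v - D t f := by
      rw [← hsum, map_add, map_add, map_smul]
      abel
    rw [this]
    refine (norm_sub_le _ _).trans ((add_le_add (hv t ht) (hf t ht)).trans_eq ?_)
    ring
  have hexp : ∀ t : ℝ, 0 ≤ t → Real.exp (-lam * t) ≤ 1 := fun t ht =>
    Real.exp_le_one_iff.2 (by nlinarith)
  -- the forward images of `g` stay bounded, while `g` is contracted in backward time
  have hg0 : g = 0 := by
    rw [← norm_le_zero_iff]
    refine le_zero_of_forall_le_mul_exp (k := C * (C * (‖v‖ + ‖f‖) + |c| * m')) hlam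
      fun t ht => (hg t ht).trans ?_
    have h1 : ‖D t g‖ ≤ C * (‖v‖ + ‖f‖) + |c| * m' := by
      have e : D t g = (c • D t X + D t g) - c • D t X := by abel
      rw [e]
      refine (norm_sub_le _ _).trans (add_le_add ?_ ?_)
      · refine (hw t ht).trans ?_
        have : 0 ≤ C * (‖v‖ + ‖f‖) := by positivity
        nlinarith [hexp t ht]
      · rw [norm_smul, Real.norm_eq_abs]
        exact mul_le_mul_of_nonneg_left (hX t ht).2 (abs_nonneg c)
    calc C * Real.exp (-lam * t) * ‖D t g‖
        ≤ C * Real.exp (-lam * t) * (C * (‖v‖ + ‖f‖) + |c| * m') := by gcongr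
      _ = _ := by ring
  refine ⟨?_, hg0⟩
  have : |c| * m ≤ 0 := le_zero_of_forall_le_mul_exp (k := C * (‖v‖ + ‖f‖)) hlam fun t ht => by
    have := hw t ht
    rw [hg0, _root_.map_zero, add_zero, norm_smul, Real.norm_eq_abs] at this
    exact (mul_le_mul_of_nonneg_left (hX t ht).1 (abs_nonneg c)).trans this
  have h0 : |c| ≤ 0 := by
    by_contra h
    push Not at h
    nlinarith [mul_pos h hm]
  exact abs_nonpos_iff.1 h0

variable {E : Type*} [NormedAddCommGroup E] [NormedSpace ℝ E]
  {M : Type*} [MetricSpace M] [ChartedSpace E M] [IsManifold 𝓘(ℝ, E) 1 M]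
  [RiemannianBundle (fun x : M => TangentSpace 𝓘(ℝ, E) x)]
  [IsContinuousRiemannianBundle E (fun x : M => TangentSpace 𝓘(ℝ, E) x)] {ϕ : Flow ℝ M}

omit [IsManifold 𝓘(ℝ, E) 1 M] in
/-- The data of the definition of uniform hyperbolicity, with named clauses. -/
structure IsHyperbolicSplitting (ϕ : Flow ℝ M) (Λ : Set M)
    (Es Eu : ∀ x : M, Submodule ℝ (TangentSpace 𝓘(ℝ, E) x)) (C lam : ℝ) : Prop where
  const_pos : 0 < C
  rate_pos : 0 < lam
  velocity_ne_zero : ∀ x ∈ Λ, velocity (E := E) ϕ x ≠ 0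
  isInternal : ∀ x ∈ Λ,
    DirectSum.IsInternal ![Submodule.span ℝ {velocity (E := E) ϕ x}, Es x, Eu x]
  map_stable : ∀ x ∈ Λ, ∀ t : ℝ,
    (Es x).map (tangentMapAt (E := E) ϕ t x).toLinearMap = Es (ϕ t x)
  map_unstable : ∀ x ∈ Λ, ∀ t : ℝ,
    (Eu x).map (tangentMapAt (E := E) ϕ t x).toLinearMap = Eu (ϕ t x)
  norm_stable_le : ∀ x ∈ Λ, ∀ t : ℝ, 0 ≤ t → ∀ v ∈ Es x,
    ‖tangentMapAt (E := E) ϕ t x v‖ ≤ C * Real.exp (-lam * t) * ‖v‖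
  norm_unstable_le : ∀ x ∈ Λ, ∀ t : ℝ, 0 ≤ t → ∀ v ∈ Eu x,
    ‖tangentMapAt (E := E) ϕ (-t) x v‖ ≤ C * Real.exp (-lam * t) * ‖v‖

theorem continuousOn_norm_tangent {Y : Type*} [TopologicalSpace Y] {s : Set Y}
    {f : Y → TangentBundle 𝓘(ℝ, E) M} (hf : ContinuousOn f s) :
    ContinuousOn (fun y => ‖(f y).2‖) s := by
  have := ContinuousOn.inner_bundle (F := E) (E := fun x : M => TangentSpace 𝓘(ℝ, E) x)
    (b := fun y => (f y).1) (v := fun y => (f y).2) (w := fun y => (f y).2) hf hf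
  refine this.sqrt.congr fun y _ => ?_
  exact norm_eq_sqrt_real_inner _

omit [RiemannianBundle (fun x : M => TangentSpace 𝓘(ℝ, E) x)]
  [IsContinuousRiemannianBundle E (fun x : M => TangentSpace 𝓘(ℝ, E) x)] in
theorem continuous_tangentMap_flow
    (hϕ : ContMDiff (𝓘(ℝ, ℝ).prod 𝓘(ℝ, E)) 𝓘(ℝ, E) 1 (fun p : ℝ × M => ϕ p.1 p.2)) (t : ℝ) :
    Continuous (tangentMap 𝓘(ℝ, E) 𝓘(ℝ, E) (ϕ t)) :=
  (contMDiff_flow hϕ t).continuous_tangentMap le_rfl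

omit [IsContinuousRiemannianBundle E (fun x : M => TangentSpace 𝓘(ℝ, E) x)]
  [IsManifold 𝓘(ℝ, E) 1 M] in
theorem norm_tangentMapAt_neg_tangentMapAt
    (hϕ : ContMDiff (𝓘(ℝ, ℝ).prod 𝓘(ℝ, E)) 𝓘(ℝ, E) 1 (fun p : ℝ × M => ϕ p.1 p.2)) (t : ℝ)
    (q : M) (v : TangentSpace 𝓘(ℝ, E) q) :
    ‖tangentMapAt (E := E) ϕ (-t) (ϕ t q) (tangentMapAt (E := E) ϕ t q v)‖ = ‖v‖ := by
  have h1 := tangentMap_comp_at (⟨q, v⟩ : TangentBundle 𝓘(ℝ, E) M)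
    ((contMDiff_flow hϕ (-t)).mdifferentiable one_ne_zero (ϕ t q))
    ((contMDiff_flow hϕ t).mdifferentiable one_ne_zero q)
  have h2 : ϕ (-t) ∘ ϕ t = id := funext fun x => flow_neg_flow ϕ t x
  rw [h2, tangentMap_id] at h1
  exact congrArg (fun w : TangentBundle 𝓘(ℝ, E) M => ‖w.2‖) h1.symm

theorem exists_norm_velocity_bounds
    (hϕ : ContMDiff (𝓘(ℝ, ℝ).prod 𝓘(ℝ, E)) 𝓘(ℝ, E) 1 (fun p : ℝ × M => ϕ p.1 p.2))
    {Λ : Set M} (hΛ : IsCompact Λ) (hne : ∀ x ∈ Λ, velocity (E := E) ϕ x ≠ 0) :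
    ∃ m m' : ℝ, 0 < m ∧ ∀ x ∈ Λ, m ≤ ‖velocity (E := E) ϕ x‖ ∧ ‖velocity (E := E) ϕ x‖ ≤ m' := by
  have hc : ContinuousOn (fun x => ‖velocity (E := E) ϕ x‖) Λ :=
    continuousOn_norm_tangent (f := fun q => (⟨q, velocity ϕ q⟩ : TangentBundle 𝓘(ℝ, E) M))
      (continuous_velocity hϕ).continuousOn
  rcases Λ.eq_empty_or_nonempty with h0 | h0
  · exact ⟨1, 1, one_pos, by simp [h0]⟩
  obtain ⟨x, hx, hmin⟩ := hΛ.exists_isMinOn h0 hc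
  obtain ⟨x', hx', hmax⟩ := hΛ.exists_isMaxOn h0 hc
  refine ⟨‖velocity (E := E) ϕ x‖, ‖velocity (E := E) ϕ x'‖, norm_pos_iff.2 (hne x hx),
    fun y hy => ⟨?_, ?_⟩⟩
  · exact isMinOn_iff.1 hmin y hy
  · exact isMaxOn_iff.1 hmax y hy

namespace IsHyperbolicSplitting

variable {Λ : Set M} {Es Eu : ∀ x : M, Submodule ℝ (TangentSpace 𝓘(ℝ, E) x)} {C lam : ℝ}

/-- The stable space consists of all vectors that contract with the prescribed constants. -/
theorem mem_stable_iff (h : IsHyperbolicSplitting ϕ Λ Es Eu C lam)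
    (hϕ : ContMDiff (𝓘(ℝ, ℝ).prod 𝓘(ℝ, E)) 𝓘(ℝ, E) 1 (fun p : ℝ × M => ϕ p.1 p.2))
    (hΛ : IsCompact Λ) (hinv : IsInvariant ϕ Λ) {q : M} (hq : q ∈ Λ)
    (v : TangentSpace 𝓘(ℝ, E) q) :
    v ∈ Es q ↔ ∀ t : ℝ, 0 ≤ t →
      ‖tangentMapAt (E := E) ϕ t q v‖ ≤ C * Real.exp (-lam * t) * ‖v‖ := by
  refine ⟨fun hv t ht => h.norm_stable_le q hq t ht v hv, fun hv => ?_⟩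
  obtain ⟨m, m', hm, hV⟩ := exists_norm_velocity_bounds hϕ hΛ h.velocity_ne_zero
  obtain ⟨⟨p, hp, hsum⟩, -⟩ := exists_projections_of_isInternal (h.isInternal q hq)
  have hsum := hsum v
  rw [Fin.sum_univ_three] at hsum
  obtain ⟨c, hc⟩ := Submodule.mem_span_singleton.1 (hp 0 v)
  have hs : p 1 v ∈ Es q := hp 1 v
  have hu : p 2 v ∈ Eu q := hp 2 v
  rw [← hc] at hsum
  obtain ⟨hc0, hg0⟩ := eq_zero_of_exponential_decay
    (fun t => (tangentMapAt (E := E) ϕ t q).toLinearMap) h.const_pos h.rate_pos hm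
    (fun t _ => by
      have := tangentMapAt_velocity hϕ t q
      simp only [ContinuousLinearMap.coe_coe, this]
      exact hV _ (hinv t hq)) hv
    (fun t ht => h.norm_stable_le q hq t ht _ hs) (fun t ht => by
      rw [← norm_tangentMapAt_neg_tangentMapAt hϕ t q (p 2 v)]
      refine h.norm_unstable_le _ (hinv t hq) t ht _ ?_
      rw [← h.map_unstable q hq t]
      exact Submodule.mem_map_of_mem hu) hsum
  rw [hc0, hg0, zero_smul, zero_add, add_zero] at hsum
  rwa [← hsum]

/-- The unstable space consists of all vectors that contract in backward time with the prescribed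
constants. -/
theorem mem_unstable_iff (h : IsHyperbolicSplitting ϕ Λ Es Eu C lam)
    (hϕ : ContMDiff (𝓘(ℝ, ℝ).prod 𝓘(ℝ, E)) 𝓘(ℝ, E) 1 (fun p : ℝ × M => ϕ p.1 p.2))
    (hΛ : IsCompact Λ) (hinv : IsInvariant ϕ Λ) {q : M} (hq : q ∈ Λ)
    (v : TangentSpace 𝓘(ℝ, E) q) :
    v ∈ Eu q ↔ ∀ t : ℝ, 0 ≤ t →
      ‖tangentMapAt (E := E) ϕ (-t) q v‖ ≤ C * Real.exp (-lam * t) * ‖v‖ := by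
  refine ⟨fun hv t ht => h.norm_unstable_le q hq t ht v hv, fun hv => ?_⟩
  obtain ⟨m, m', hm, hV⟩ := exists_norm_velocity_bounds hϕ hΛ h.velocity_ne_zero
  obtain ⟨⟨p, hp, hsum⟩, -⟩ := exists_projections_of_isInternal (h.isInternal q hq)
  have hsum := hsum v
  rw [Fin.sum_univ_three, add_right_comm] at hsum
  obtain ⟨c, hc⟩ := Submodule.mem_span_singleton.1 (hp 0 v)
  have hs : p 1 v ∈ Es q := hp 1 v
  have hu : p 2 v ∈ Eu q := hp 2 v
  rw [← hc] at hsum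
  obtain ⟨hc0, hg0⟩ := eq_zero_of_exponential_decay
    (fun t => (tangentMapAt (E := E) ϕ (-t) q).toLinearMap) h.const_pos h.rate_pos hm
    (fun t _ => by
      have := tangentMapAt_velocity hϕ (-t) q
      simp only [ContinuousLinearMap.coe_coe, this]
      exact hV _ (hinv _ hq)) hv
    (fun t ht => h.norm_unstable_le q hq t ht _ hu) (fun t ht => by
      have := norm_tangentMapAt_neg_tangentMapAt hϕ (-t) q (p 1 v)
      rw [neg_neg] at this
      rw [← this]
      refine h.norm_stable_le _ (hinv _ hq) t ht _ ?_
      rw [← h.map_stable q hq (-t)]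
      exact Submodule.mem_map_of_mem hs) hsum
  rw [hc0, hg0, zero_smul, zero_add, add_zero] at hsum
  rwa [← hsum]

end IsHyperbolicSplitting

end HyperbolicSplitting

/-! ### The hyperbolic dynamics in charts -/

section HyperbolicCharts

variable {E : Type*} [NormedAddCommGroup E] [NormedSpace ℝ E]
  {M : Type*} [MetricSpace M] [ChartedSpace E M] [IsManifold 𝓘(ℝ, E) 1 M]
  [RiemannianBundle (fun x : M => TangentSpace 𝓘(ℝ, E) x)]
  [IsContinuousRiemannianBundle E (fun x : M => TangentSpace 𝓘(ℝ, E) x)] {ϕ : Flow ℝ M}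
  {Λ : Set M} {Es Eu : ∀ x : M, Submodule ℝ (TangentSpace 𝓘(ℝ, E) x)} {C lam : ℝ}

/-- The neutral, stable and unstable summands at `q`, in the coordinates of the chart centred at
`a`. -/
noncomputable def chartSplitting (ϕ : Flow ℝ M)
    (Es Eu : ∀ x : M, Submodule ℝ (TangentSpace 𝓘(ℝ, E) x)) (a : M) (i : Fin 3) (q : M) :
    Submodule ℝ E :=
  (![Submodule.span ℝ {velocity (E := E) ϕ q}, Es q, Eu q] i).comap
    (chartVec (E := E) a q).toLinearMap

/-- In coordinates, the Riemannian norm is equivalent to the norm of the model space, uniformly on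
compact sets. -/
theorem exists_norm_chartVec_bounds [FiniteDimensional ℝ E] {a : M} {K : Set M} (hK : IsCompact K)
    (hKa : K ⊆ (chartAt E a).source) :
    ∃ c ≥ (1 : ℝ), ∀ q ∈ K, ∀ v : E, ‖chartVec (E := E) a q v‖ ≤ c * ‖v‖ ∧
      ‖v‖ ≤ c * ‖chartVec (E := E) a q v‖ := by
  let Z : Set (M × E) := K ×ˢ Metric.sphere 0 1
  have hZ : IsCompact Z := hK.prod (isCompact_sphere _ _)
  have hc : ContinuousOn (fun p : M × E => ‖chartVec (E := E) a p.1 p.2‖) Z :=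
    continuousOn_norm_tangent
      (f := fun p : M × E => (⟨p.1, chartVec a p.1 p.2⟩ : TangentBundle 𝓘(ℝ, E) M))
      ((continuousOn_chartVec a).mono (prod_mono hKa (subset_univ _)))
  have hbound : ∃ m M' : ℝ, 0 < m ∧ ∀ p ∈ Z, m ≤ ‖chartVec (E := E) a p.1 p.2‖ ∧
      ‖chartVec (E := E) a p.1 p.2‖ ≤ M' := by
    rcases Z.eq_empty_or_nonempty with h0 | h0
    · exact ⟨1, 1, one_pos, by simp [h0]⟩
    obtain ⟨x, hx, hmin⟩ := hZ.exists_isMinOn h0 hc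
    obtain ⟨x', hx', hmax⟩ := hZ.exists_isMaxOn h0 hc
    refine ⟨‖chartVec (E := E) a x.1 x.2‖, ‖chartVec (E := E) a x'.1 x'.2‖, norm_pos_iff.2 ?_,
      fun y hy => ⟨isMinOn_iff.1 hmin y hy, isMaxOn_iff.1 hmax y hy⟩⟩
    intro h
    have h2 := chartCoord_chartVec (hKa hx.1) x.2
    rw [h, _root_.map_zero] at h2
    have h3 : ‖x.2‖ = 1 := by simpa using hx.2
    rw [← h2, norm_zero] at h3
    exact zero_ne_one h3
  obtain ⟨m, M', hm, H⟩ := hbound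
  refine ⟨max 1 (max M' m⁻¹), le_max_left _ _, fun q hq v => ?_⟩
  rcases eq_or_ne v 0 with rfl | hv
  · simp
  have hv' : 0 < ‖v‖ := norm_pos_iff.2 hv
  obtain ⟨h1, h2⟩ := H (q, ‖v‖⁻¹ • v) ⟨hq, by simp [norm_smul, hv'.ne']⟩
  simp only [map_smul, norm_smul, norm_inv, norm_norm] at h1 h2
  rw [inv_mul_le_iff₀ hv'] at h2
  rw [inv_mul_eq_div, le_div_iff₀ hv'] at h1
  constructor
  · refine h2.trans ?_
    rw [mul_comm]
    gcongr
    exact (le_max_left _ _).trans (le_max_right _ _)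
  · calc ‖v‖ = m⁻¹ * (m * ‖v‖) := by field_simp
      _ ≤ m⁻¹ * ‖chartVec (E := E) a q v‖ := by gcongr
      _ ≤ _ := by
        gcongr
        exact (le_max_right _ _).trans (le_max_right _ _)

namespace IsHyperbolicSplitting

/-- The three summands of the hyperbolic splitting are closed subsets of the tangent bundle over
`Λ`: the stable and unstable ones by their characterisation through inequalities, the neutral one
by the equality case of the Cauchy-Schwarz inequality. -/
theorem isClosed_chartSplitting (h : IsHyperbolicSplitting ϕ Λ Es Eu C lam)
    (hϕ : ContMDiff (𝓘(ℝ, ℝ).prod 𝓘(ℝ, E)) 𝓘(ℝ, E) 1 (fun p : ℝ × M => ϕ p.1 p.2))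
    (hΛ : IsCompact Λ) (hinv : IsInvariant ϕ Λ) {a : M} {K : Set M} (hK : IsCompact K)
    (hKΛ : K ⊆ Λ) (hKa : K ⊆ (chartAt E a).source) (i : Fin 3) :
    IsClosed {p : M × E | p.1 ∈ K ∧ p.2 ∈ chartSplitting ϕ Es Eu a i p.1} := by
  have hcl : IsClosed (K ×ˢ (univ : Set E)) := hK.isClosed.prod isClosed_univ
  have hc : ContinuousOn
      (fun p : M × E => (⟨p.1, chartVec a p.1 p.2⟩ : TangentBundle 𝓘(ℝ, E) M)) (K ×ˢ univ) :=
    (continuousOn_chartVec a).mono (prod_mono hKa (subset_univ _))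
  have hc0 : ContinuousOn (fun p : M × E => ‖chartVec (E := E) a p.1 p.2‖) (K ×ˢ univ) :=
    continuousOn_norm_tangent
      (f := fun p : M × E => (⟨p.1, chartVec a p.1 p.2⟩ : TangentBundle 𝓘(ℝ, E) M)) hc
  have hct : ∀ t : ℝ, ContinuousOn
      (fun p : M × E => ‖tangentMapAt (E := E) ϕ t p.1 (chartVec (E := E) a p.1 p.2)‖)
      (K ×ˢ univ) := fun t =>
    continuousOn_norm_tangent
      (f := fun p : M × E => tangentMap 𝓘(ℝ, E) 𝓘(ℝ, E) (ϕ t)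
        (⟨p.1, chartVec a p.1 p.2⟩ : TangentBundle 𝓘(ℝ, E) M))
      ((continuous_tangentMap_flow hϕ t).comp_continuousOn hc)
  -- a set cut out by inequalities between continuous functions, one for each nonnegative time
  have hforall : ∀ (σ : ℝ → ℝ), IsClosed {p : M × E | p.1 ∈ K ∧ ∀ t : ℝ, 0 ≤ t →
      ‖tangentMapAt (E := E) ϕ (σ t) p.1 (chartVec (E := E) a p.1 p.2)‖ ≤
        C * Real.exp (-lam * t) * ‖chartVec (E := E) a p.1 p.2‖} := by
    intro σ
    have : {p : M × E | p.1 ∈ K ∧ ∀ t : ℝ, 0 ≤ t →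
        ‖tangentMapAt (E := E) ϕ (σ t) p.1 (chartVec (E := E) a p.1 p.2)‖ ≤
          C * Real.exp (-lam * t) * ‖chartVec (E := E) a p.1 p.2‖} =
        ⋂ t : Ici (0 : ℝ), {p : M × E | p ∈ K ×ˢ (univ : Set E) ∧
          ‖tangentMapAt (E := E) ϕ (σ t) p.1 (chartVec (E := E) a p.1 p.2)‖ ≤
          C * Real.exp (-lam * t) * ‖chartVec (E := E) a p.1 p.2‖} := by
      ext p
      rw [mem_iInter]
      constructor
      · rintro ⟨h1, h2⟩ t
        exact ⟨⟨h1, mem_univ _⟩, h2 t t.2⟩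
      · intro h1
        exact ⟨(h1 ⟨0, self_mem_Ici⟩).1.1, fun t ht => (h1 ⟨t, ht⟩).2⟩
    rw [this]
    exact isClosed_iInter fun t => hcl.isClosed_le (hct _) (continuousOn_const.mul hc0)
  fin_cases i
  · have hcv : ContinuousOn (fun p : M × E => ‖velocity (E := E) ϕ p.1‖) (K ×ˢ univ) :=
      continuousOn_norm_tangent
        (f := fun p : M × E => (⟨p.1, velocity ϕ p.1⟩ : TangentBundle 𝓘(ℝ, E) M))
        ((continuous_velocity hϕ).comp continuous_fst).continuousOn
    have hci : ContinuousOn (fun p : M × E => inner ℝ (velocity (E := E) ϕ p.1)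
        (chartVec (E := E) a p.1 p.2)) (K ×ˢ univ) :=
      ContinuousOn.inner_bundle (F := E) (E := fun x : M => TangentSpace 𝓘(ℝ, E) x)
        (b := fun p : M × E => p.1) (v := fun p => velocity (E := E) ϕ p.1)
        (w := fun p => chartVec (E := E) a p.1 p.2)
        ((continuous_velocity hϕ).comp continuous_fst).continuousOn hc
    have := hcl.isClosed_le (hcv.mul hc0) hci.norm
    convert this using 1
    ext p
    have key : p.1 ∈ K → (p.2 ∈ chartSplitting ϕ Es Eu a 0 p.1 ↔
        ‖velocity (E := E) ϕ p.1‖ * ‖chartVec (E := E) a p.1 p.2‖ ≤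
          ‖inner ℝ (velocity (E := E) ϕ p.1) (chartVec (E := E) a p.1 p.2)‖) := by
      intro hp
      change chartVec (E := E) a p.1 p.2 ∈ Submodule.span ℝ {velocity (E := E) ϕ p.1} ↔ _
      have hV := h.velocity_ne_zero p.1 (hKΛ hp)
      rw [Submodule.mem_span_singleton]
      constructor
      · rintro ⟨c, hc⟩
        rw [← hc, norm_smul, inner_smul_right, norm_mul, real_inner_self_eq_norm_mul_norm]
        refine le_of_eq ?_
        rw [norm_mul, norm_norm]
        ring
      · intro hle
        rcases eq_or_ne (chartVec (E := E) a p.1 p.2) 0 with h0 | h0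
        · exact ⟨0, by rw [h0, zero_smul]⟩
        have heq := le_antisymm (norm_inner_le_norm (𝕜 := ℝ) _ _) hle
        obtain ⟨c, -, hc⟩ := (norm_inner_eq_norm_iff hV h0).1 heq
        exact ⟨c, hc.symm⟩
    constructor
    · rintro ⟨h1, h2⟩
      exact ⟨⟨h1, mem_univ _⟩, (key h1).1 h2⟩
    · rintro ⟨h1, h2⟩
      exact ⟨h1.1, (key h1.1).2 h2⟩
  · convert hforall (fun t => t) using 1
    ext p
    refine and_congr_right fun hp => ?_
    exact h.mem_stable_iff hϕ hΛ hinv (hKΛ hp) (chartVec (E := E) a p.1 p.2)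
  · convert hforall (fun t => -t) using 1
    ext p
    refine and_congr_right fun hp => ?_
    exact h.mem_unstable_iff hϕ hΛ hinv (hKΛ hp) (chartVec (E := E) a p.1 p.2)

/-- In coordinates, the projections of the hyperbolic splitting exist and are bounded and
continuous on compact sets. -/
theorem exists_chart_projections [FiniteDimensional ℝ E]
    (h : IsHyperbolicSplitting ϕ Λ Es Eu C lam)
    (hϕ : ContMDiff (𝓘(ℝ, ℝ).prod 𝓘(ℝ, E)) 𝓘(ℝ, E) 1 (fun p : ℝ × M => ϕ p.1 p.2))
    (hΛ : IsCompact Λ) (hinv : IsInvariant ϕ Λ) {a : M} {K : Set M} (hK : IsCompact K)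
    (hKΛ : K ⊆ Λ) (hKa : K ⊆ (chartAt E a).source) :
    ∃ (P : Fin 3 → M → E →L[ℝ] E) (A : ℝ), 0 < A ∧
      (∀ q ∈ K, ∀ i v, P i q v ∈ chartSplitting ϕ Es Eu a i q) ∧
      (∀ q ∈ K, ∀ v, ∑ i, P i q v = v) ∧ (∀ q ∈ K, ∀ i v, ‖P i q v‖ ≤ A * ‖v‖) ∧
      ∀ i, ContinuousOn (P i) K := by
  have hex : ∀ q : M, ∃ P : Fin 3 → E →L[ℝ] E, q ∈ K →
      (∀ i v, P i v ∈ chartSplitting ϕ Es Eu a i q) ∧ ∀ v, ∑ i, P i v = v := by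
    intro q
    by_cases hq : q ∈ K
    · obtain ⟨⟨p, hp, hsum⟩, -⟩ := exists_projections_of_isInternal (h.isInternal q (hKΛ hq))
      refine ⟨fun i => LinearMap.toContinuousLinearMap ((chartCoord (E := E) a q).toLinearMap ∘ₗ
        p i ∘ₗ (chartVec (E := E) a q).toLinearMap), fun _ => ⟨fun i v => ?_, fun v => ?_⟩⟩
      · change chartVec (E := E) a q (chartCoord (E := E) a q (p i (chartVec (E := E) a q v))) ∈
          ![Submodule.span ℝ {velocity (E := E) ϕ q}, Es q, Eu q] i
        rw [chartVec_chartCoord (hKa hq)]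
        exact hp i _
      · have h1 := congrArg (chartCoord (E := E) a q) (hsum (chartVec (E := E) a q v))
        rw [map_sum, chartCoord_chartVec (hKa hq)] at h1
        exact h1
    · exact ⟨0, fun hq' => absurd hq' hq⟩
  choose P hP using hex
  have hind : ∀ q ∈ K, ∀ s : Fin 3 → E, (∀ i, s i ∈ chartSplitting ϕ Es Eu a i q) →
      ∑ i, s i = 0 → s = 0 := by
    intro q hq s hs h0
    have h1 := (exists_projections_of_isInternal (h.isInternal q (hKΛ hq))).2
      (fun i => chartVec (E := E) a q (s i)) hs (by rw [← map_sum, h0, _root_.map_zero])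
    funext i
    have h2 := congrArg (chartCoord (E := E) a q) (congrFun h1 i)
    simp only [Pi.zero_apply, _root_.map_zero] at h2
    rw [chartCoord_chartVec (hKa hq)] at h2
    exact h2
  have hcl := h.isClosed_chartSplitting hϕ hΛ hinv hK hKΛ hKa
  obtain ⟨A, hA, hbd⟩ := exists_norm_projection_le (P := fun i q => P q i) hK hcl hind
    (fun q hq => (hP q hq).1) (fun q hq => (hP q hq).2)
  exact ⟨fun i q => P q i, A, hA, fun q hq => (hP q hq).1, fun q hq => (hP q hq).2, hbd,
    continuousOn_projection hK hcl hind (fun q hq => (hP q hq).1) (fun q hq => (hP q hq).2)⟩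

omit [IsContinuousRiemannianBundle E (fun x : M => TangentSpace 𝓘(ℝ, E) x)] in
/-- One step of the hyperbolic dynamics in coordinates: the derivative `D` of `chartFlow`
contracts the stable space strongly, and on the other two summands it has a right inverse
`(c, B)`, where `B` contracts strongly. -/
theorem exists_chart_inverse [FiniteDimensional ℝ E]
    (h : IsHyperbolicSplitting ϕ Λ Es Eu C lam)
    (hϕ : ContMDiff (𝓘(ℝ, ℝ).prod 𝓘(ℝ, E)) 𝓘(ℝ, E) 1 (fun p : ℝ × M => ϕ p.1 p.2))
    {T : ℝ} (hT : 0 ≤ T) {a b q : M} (hq : q ∈ Λ)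
    (hqa : q ∈ (chartAt E a).source) (hqb : ϕ T q ∈ (chartAt E b).source)
    (hqΛ : ϕ T q ∈ Λ)
    {ka kb A m : ℝ} (hka : 0 ≤ ka) (hkb : 0 ≤ kb) (hm : 0 < m)
    (hna : ∀ v : E, ‖chartVec (E := E) a q v‖ ≤ ka * ‖v‖ ∧ ‖v‖ ≤ ka * ‖chartVec (E := E) a q v‖)
    (hnb : ∀ v : E, ‖chartVec (E := E) b (ϕ T q) v‖ ≤ kb * ‖v‖ ∧
      ‖v‖ ≤ kb * ‖chartVec (E := E) b (ϕ T q) v‖)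
    (hV : m ≤ ‖velocity (E := E) ϕ (ϕ T q)‖)
    {Pa Pb : Fin 3 → E →L[ℝ] E} (hPa : ∀ i v, Pa i v ∈ chartSplitting ϕ Es Eu a i q)
    (hPb : ∀ i v, Pb i v ∈ chartSplitting ϕ Es Eu b i (ϕ T q)) (hsum : ∀ v, ∑ i, Pb i v = v)
    (hPaA : ∀ i v, ‖Pa i v‖ ≤ A * ‖v‖) (hPbA : ∀ i v, ‖Pb i v‖ ≤ A * ‖v‖) :
    ∃ (B : E →L[ℝ] E) (c : E →L[ℝ] ℝ),
      (∀ g, g - Pb 1 g - fderiv ℝ (chartFlow E ϕ T a b) (0, extChartAt 𝓘(ℝ, E) a q)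
        (c g, B g) = 0) ∧
      (∀ g, ‖B g‖ ≤ ka * kb * C * A * Real.exp (-lam * T) * ‖g‖) ∧
      (∀ g, ‖c g‖ ≤ kb * A / m * ‖g‖) ∧
      ∀ g, ‖fderiv ℝ (chartFlow E ϕ T a b) (0, extChartAt 𝓘(ℝ, E) a q) (0, Pa 1 g)‖ ≤
        ka * kb * C * A * Real.exp (-lam * T) * ‖g‖ := by
  have hC := h.const_pos
  have hVne := h.velocity_ne_zero _ hqΛ
  -- the coordinate along the flow
  let e := LinearEquiv.toSpanNonzeroSingleton ℝ (TangentSpace 𝓘(ℝ, E) (ϕ T q))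
    (velocity (E := E) ϕ (ϕ T q)) hVne
  let c' : E →ₗ[ℝ] ℝ := e.symm.toLinearMap ∘ₗ LinearMap.codRestrict _
    ((chartVec (E := E) b (ϕ T q)).toLinearMap ∘ₗ (Pb 0).toLinearMap) (hPb 0)
  have hc' : ∀ g, c' g • velocity (E := E) ϕ (ϕ T q) = chartVec (E := E) b (ϕ T q) (Pb 0 g) := by
    intro g
    have h1 := e.apply_symm_apply ⟨chartVec (E := E) b (ϕ T q) (Pb 0 g), hPb 0 g⟩
    exact congrArg Subtype.val h1
  -- the inverse of the derivative of the flow on the unstable space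
  have hmaps : ∀ v ∈ Eu q, (tangentMapAt (E := E) ϕ T q).toLinearMap v ∈ Eu (ϕ T q) := by
    intro v hv
    rw [← h.map_unstable q hq T]
    exact Submodule.mem_map_of_mem hv
  obtain ⟨s, hs⟩ := LinearMap.exists_rightInverse_of_surjective
    ((tangentMapAt (E := E) ϕ T q).toLinearMap.restrict hmaps) (by
      rw [LinearMap.range_eq_top]
      rintro ⟨w, hw⟩
      rw [← h.map_unstable q hq T] at hw
      obtain ⟨v, hv, rfl⟩ := hw
      exact ⟨⟨v, hv⟩, rfl⟩)
  let s' : E →ₗ[ℝ] TangentSpace 𝓘(ℝ, E) q := (Eu q).subtype ∘ₗ s ∘ₗ LinearMap.codRestrict _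
    ((chartVec (E := E) b (ϕ T q)).toLinearMap ∘ₗ (Pb 2).toLinearMap) (hPb 2)
  have hs'mem : ∀ g, s' g ∈ Eu q := fun g => (s _).2
  have hs' : ∀ g, tangentMapAt (E := E) ϕ T q (s' g) = chartVec (E := E) b (ϕ T q) (Pb 2 g) := by
    intro g
    have h1 := LinearMap.congr_fun hs ⟨chartVec (E := E) b (ϕ T q) (Pb 2 g), hPb 2 g⟩
    exact congrArg Subtype.val h1
  have hs'norm : ∀ g, ‖s' g‖ ≤ C * Real.exp (-lam * T) * (kb * (A * ‖g‖)) := by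
    intro g
    rw [← norm_tangentMapAt_neg_tangentMapAt hϕ T q (s' g)]
    refine (h.norm_unstable_le _ hqΛ T hT _ (hmaps _ (hs'mem g))).trans ?_
    gcongr
    rw [ContinuousLinearMap.coe_coe, hs']
    exact (hnb _).1.trans (mul_le_mul_of_nonneg_left (hPbA 2 g) hkb)
  refine ⟨LinearMap.toContinuousLinearMap ((chartCoord (E := E) a q).toLinearMap ∘ₗ s'),
    LinearMap.toContinuousLinearMap c', fun g => ?_, fun g => ?_, fun g => ?_, fun g => ?_⟩
  · rw [fderiv_chartFlow hϕ hqa hqb]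
    simp only [LinearMap.coe_toContinuousLinearMap', LinearMap.comp_apply,
      ContinuousLinearMap.coe_coe]
    rw [chartVec_chartCoord hqa, hs', ← map_smul, hc', chartCoord_chartVec hqb,
      chartCoord_chartVec hqb]
    have := hsum g
    rw [Fin.sum_univ_three] at this
    nth_rewrite 1 [← this]
    abel
  · simp only [LinearMap.coe_toContinuousLinearMap', LinearMap.comp_apply,
      ContinuousLinearMap.coe_coe]
    refine (hna _).2.trans ?_
    rw [chartVec_chartCoord hqa]
    refine (mul_le_mul_of_nonneg_left (hs'norm g) hka).trans_eq ?_
    ring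
  · simp only [LinearMap.coe_toContinuousLinearMap']
    rw [div_mul_eq_mul_div, le_div_iff₀ hm]
    calc ‖c' g‖ * m ≤ ‖c' g‖ * ‖velocity (E := E) ϕ (ϕ T q)‖ := by gcongr
      _ = ‖chartVec (E := E) b (ϕ T q) (Pb 0 g)‖ := by rw [← hc', norm_smul]
      _ ≤ kb * ‖Pb 0 g‖ := (hnb _).1
      _ ≤ kb * (A * ‖g‖) := by gcongr; exact hPbA 0 g
      _ = kb * A * ‖g‖ := by ring
  · rw [fderiv_chartFlow hϕ hqa hqb, zero_smul, add_zero]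
    refine (hnb _).2.trans ?_
    rw [chartVec_chartCoord hqb]
    refine (mul_le_mul_of_nonneg_left (h.norm_stable_le q hq T hT _ (hPa 1 g)) hkb).trans ?_
    calc kb * (C * Real.exp (-lam * T) * ‖chartVec (E := E) a q (Pa 1 g)‖)
        ≤ kb * (C * Real.exp (-lam * T) * (ka * (A * ‖g‖))) := by
          gcongr
          exact (hna _).1.trans (mul_le_mul_of_nonneg_left (hPaA 1 g) hka)
      _ = _ := by ring

end IsHyperbolicSplitting

end HyperbolicCharts

/-! ### Uniform hyperbolicity in finitely many charts -/

section UniformCharts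

theorem exists_pos_forall_mem_finset {α : Type*} (J : Finset α) {p : α → ℝ → Prop}
    (hmono : ∀ a x y, 0 < y → y ≤ x → p a x → p a y) (h : ∀ a, ∃ δ > 0, p a δ) :
    ∃ δ > 0, ∀ a ∈ J, p a δ := by
  classical
  induction J using Finset.induction_on with
  | empty => exact ⟨1, one_pos, by simp⟩
  | insert a J _ ih =>
    obtain ⟨δ, hδ, H⟩ := ih
    obtain ⟨δ', hδ', H'⟩ := h a
    have hpos := lt_min hδ hδ'
    refine ⟨min δ δ', hpos, fun b hb => ?_⟩
    rcases Finset.mem_insert.1 hb with rfl | hb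
    · exact hmono _ _ _ hpos (min_le_right _ _) H'
    · exact hmono _ _ _ hpos (min_le_left _ _) (H b hb)

theorem exists_forall_mem_finset_le {α : Type*} (J : Finset α) (f : α → ℝ) :
    ∃ A : ℝ, 1 ≤ A ∧ ∀ a ∈ J, f a ≤ A := by
  obtain ⟨A, hA⟩ := (J.finite_toSet.image f).bddAbove
  exact ⟨max 1 A, le_max_left _ _, fun a ha =>
    (hA (mem_image_of_mem f ha)).trans (le_max_right _ _)⟩

variable {E : Type*} [NormedAddCommGroup E] [NormedSpace ℝ E]
  {M : Type*} [MetricSpace M] [ChartedSpace E M]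

omit [NormedSpace ℝ E] in
variable (E) in
/-- A compact set is covered by finitely many charts, each point lying uniformly deep in one. -/
theorem exists_finite_chart_cover {Λ : Set M} (hΛ : IsCompact Λ) :
    ∃ (J : Finset M) (K : M → Set M) (δ : ℝ), 0 < δ ∧
      (∀ a, IsCompact (K a) ∧ K a ⊆ Λ ∧ K a ⊆ (chartAt E a).source) ∧
      ∀ q ∈ Λ, ∃ a ∈ J, ∀ q' ∈ Λ, dist q' q < δ → q' ∈ K a := by
  have hr : ∀ a : M, ∃ r > 0, Metric.closedBall a (2 * r) ⊆ (chartAt E a).source := fun a => by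
    obtain ⟨r, hr, H⟩ := Metric.nhds_basis_closedBall.mem_iff.1
      ((chartAt E a).open_source.mem_nhds (mem_chart_source E a))
    exact ⟨r / 2, by positivity, by rwa [mul_div_cancel₀ r two_ne_zero]⟩
  choose r hr0 hr using hr
  obtain ⟨J, -, hJ⟩ := hΛ.elim_nhds_subcover (fun a => Metric.ball a (r a))
    fun a _ => Metric.ball_mem_nhds a (hr0 a)
  obtain ⟨δ, hδ, Hδ⟩ := exists_pos_forall_mem_finset J (p := fun a δ => δ ≤ r a)
    (fun a x y _ hyx hx => hyx.trans hx) fun a => ⟨r a, hr0 a, le_rfl⟩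
  refine ⟨J, fun a => Λ ∩ Metric.closedBall a (2 * r a), δ, hδ, fun a =>
    ⟨hΛ.inter_right Metric.isClosed_closedBall, inter_subset_left,
      inter_subset_right.trans (hr a)⟩, fun q hq => ?_⟩
  obtain ⟨a, ha, hqa⟩ := mem_iUnion₂.1 (hJ hq)
  refine ⟨a, ha, fun q' hq' hd => ⟨hq', ?_⟩⟩
  rw [Metric.mem_closedBall]
  rw [Metric.mem_ball] at hqa
  linarith [dist_triangle q' q a, Hδ a ha]

/-- A point near a compact part of a chart domain has coordinates near those of that part. -/
theorem exists_forall_norm_extChartAt_sub_lt (J : Finset M) {K : M → Set M}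
    (hK : ∀ a, IsCompact (K a)) (hKa : ∀ a, K a ⊆ (chartAt E a).source) {γ : ℝ} (hγ : 0 < γ) :
    ∃ δ > 0, ∀ a ∈ J, ∀ q ∈ K a, ∀ x, dist x q < δ → x ∈ (chartAt E a).source ∧
      ‖extChartAt 𝓘(ℝ, E) a x - extChartAt 𝓘(ℝ, E) a q‖ < γ := by
  refine exists_pos_forall_mem_finset J (fun a x y _ hyx hx q hq z hz =>
    hx q hq z (hz.trans_le hyx)) fun a => ?_
  obtain ⟨δ₁, hδ₁, H₁⟩ := exists_ball_subset_of_isCompact (hK a) (chartAt E a).open_source (hKa a)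
  obtain ⟨δ₂, hδ₂, H₂⟩ := exists_forall_dist_lt_of_isCompact (hK a)
    (f := extChartAt 𝓘(ℝ, E) a) (fun k hk => continuousAt_extChartAt'
      (by rw [extChartAt_source]; exact hKa a hk)) hγ
  refine ⟨min δ₁ δ₂, lt_min hδ₁ hδ₂, fun q hq x hx =>
    ⟨H₁ q hq x (hx.trans_le (min_le_left _ _)), ?_⟩⟩
  rw [← dist_eq_norm]
  exact H₂ q hq x (hx.trans_le (min_le_right _ _))

/-- Inverse charts are uniformly continuous around compact sets. -/
theorem exists_forall_dist_extChartAt_symm_lt [FiniteDimensional ℝ E] (J : Finset M)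
    {K : M → Set M} (hK : ∀ a, IsCompact (K a)) (hKa : ∀ a, K a ⊆ (chartAt E a).source) :
    ∃ R > 0, ∀ ε > 0, ∃ γ > 0, ∀ a ∈ J, ∀ q ∈ K a, ∀ u w : E,
      ‖u - extChartAt 𝓘(ℝ, E) a q‖ < R → ‖w - extChartAt 𝓘(ℝ, E) a q‖ < R → ‖u - w‖ < γ →
        dist ((extChartAt 𝓘(ℝ, E) a).symm u) ((extChartAt 𝓘(ℝ, E) a).symm w) < ε := by
  have hc : ∀ a, IsCompact (extChartAt 𝓘(ℝ, E) a '' K a) := fun a =>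
    (hK a).image_of_continuousOn ((continuousOn_extChartAt a).mono
      (by rw [extChartAt_source]; exact hKa a))
  have hsub : ∀ a, extChartAt 𝓘(ℝ, E) a '' K a ⊆ (extChartAt 𝓘(ℝ, E) a).target := by
    rintro a - ⟨q, hq, rfl⟩
    exact (extChartAt 𝓘(ℝ, E) a).map_source (by rw [extChartAt_source]; exact hKa a hq)
  obtain ⟨R, hR, HR⟩ := exists_pos_forall_mem_finset J
    (p := fun a R => Metric.cthickening R (extChartAt 𝓘(ℝ, E) a '' K a) ⊆
      (extChartAt 𝓘(ℝ, E) a).target)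
    (fun a x y _ hyx hx => (Metric.cthickening_mono hyx _).trans hx)
    fun a => (hc a).exists_cthickening_subset_open (isOpen_extChartAt_target a) (hsub a)
  refine ⟨R, hR, fun ε hε => ?_⟩
  have huc : ∀ a ∈ J, UniformContinuousOn (extChartAt 𝓘(ℝ, E) a).symm
      (Metric.cthickening R (extChartAt 𝓘(ℝ, E) a '' K a)) := fun a ha =>
    (hc a).cthickening.uniformContinuousOn_of_continuous
      ((continuousOn_extChartAt_symm a).mono (HR a ha))
  obtain ⟨γ, hγ, H⟩ := exists_pos_forall_mem_finset J
    (p := fun a γ => a ∈ J → ∀ u ∈ Metric.cthickening R (extChartAt 𝓘(ℝ, E) a '' K a),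
      ∀ w ∈ Metric.cthickening R (extChartAt 𝓘(ℝ, E) a '' K a), dist u w < γ →
        dist ((extChartAt 𝓘(ℝ, E) a).symm u) ((extChartAt 𝓘(ℝ, E) a).symm w) < ε)
    (fun a x y _ hyx hx ha u hu w hw huw => hx ha u hu w hw (huw.trans_le hyx)) fun a => by
      by_cases ha : a ∈ J
      · obtain ⟨γ, hγ, H⟩ := Metric.uniformContinuousOn_iff.1 (huc a ha) ε hε
        exact ⟨γ, hγ, fun _ u hu w hw => H u hu w hw⟩
      · exact ⟨1, one_pos, fun h => absurd h ha⟩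
  refine ⟨γ, hγ, fun a ha q hq u w hu hw huw => ?_⟩
  have hmem : ∀ v : E, ‖v - extChartAt 𝓘(ℝ, E) a q‖ < R →
      v ∈ Metric.cthickening R (extChartAt 𝓘(ℝ, E) a '' K a) := fun v hv =>
    Metric.mem_cthickening_of_dist_le v _ R _ (mem_image_of_mem _ hq)
      (by rw [dist_eq_norm]; exact hv.le)
  exact H a ha ha u (hmem u hu) w (hmem w hw) (by rwa [dist_eq_norm])

variable [FiniteDimensional ℝ E] [IsManifold 𝓘(ℝ, E) 1 M]
  [RiemannianBundle (fun x : M => TangentSpace 𝓘(ℝ, E) x)]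
  [IsContinuousRiemannianBundle E (fun x : M => TangentSpace 𝓘(ℝ, E) x)] {ϕ : Flow ℝ M}
  {Λ : Set M} {Es Eu : ∀ x : M, Submodule ℝ (TangentSpace 𝓘(ℝ, E) x)} {C lam : ℝ}

/-- Uniform hyperbolicity in finitely many charts: for a suitable time `T`, every transition
between two charts along an orbit in `Λ`, up to a jump in `Λ` of size less than `δ`, satisfies the
hypotheses of `exists_solution_of_approx_hyperbolic` on balls of radius `r`. -/
theorem IsHyperbolicSplitting.exists_uniform_charts
    (h : IsHyperbolicSplitting ϕ Λ Es Eu C lam)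
    (hϕ : ContMDiff (𝓘(ℝ, ℝ).prod 𝓘(ℝ, E)) 𝓘(ℝ, E) 1 (fun p : ℝ × M => ϕ p.1 p.2))
    (hΛ : IsCompact Λ) (hinv : IsInvariant ϕ Λ) (J : Finset M) {K : M → Set M}
    (hK : ∀ a, IsCompact (K a)) (hKΛ : ∀ a, K a ⊆ Λ) (hKa : ∀ a, K a ⊆ (chartAt E a).source) :
    ∃ (T A r δ : ℝ) (P : M → M → E →L[ℝ] E), 1 ≤ T ∧ 1 ≤ A ∧ 0 < r ∧ 0 < δ ∧
      ∀ a ∈ J, ∀ b ∈ J, ∀ q ∈ K a, ϕ T q ∈ K b → ∀ q' ∈ K b, dist (ϕ T q) q' < δ →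
      ∃ (D : ℝ × E →L[ℝ] E) (B : E →L[ℝ] E) (c : E →L[ℝ] ℝ),
        (∀ g, ‖P a q g‖ ≤ A * ‖g‖) ∧ (∀ g, ‖c g‖ ≤ A * ‖g‖) ∧ (∀ g, ‖B g‖ ≤ 1 / 16 * ‖g‖) ∧
        (∀ g, ‖D (0, P a q g)‖ ≤ 1 / 16 * ‖g‖) ∧
        (∀ g, ‖g - P b q' g - D (c g, B g)‖ ≤ 1 / 16 * ‖g‖) ∧
        ∀ x y : ℝ × E, dist x (0, extChartAt 𝓘(ℝ, E) a q) < r →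
          dist y (0, extChartAt 𝓘(ℝ, E) a q) < r → x ∈ chartFlowDomain E ϕ T a b ∧
          ‖chartFlow E ϕ T a b x - chartFlow E ϕ T a b y - D (x - y)‖ ≤
            1 / (12 * A) * ‖x - y‖ := by
  choose P A hA hPmem hPsum hPA hPc using fun a =>
    h.exists_chart_projections hϕ hΛ hinv (hK a) (hKΛ a) (hKa a)
  choose k _hk hkn using fun a => exists_norm_chartVec_bounds (hK a) (hKa a)
  obtain ⟨m, _, hm, hV⟩ := exists_norm_velocity_bounds hϕ hΛ h.velocity_ne_zero
  obtain ⟨A', hA'1, hA'⟩ := exists_forall_mem_finset_le J A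
  obtain ⟨k', hk'1, hk'⟩ := exists_forall_mem_finset_le J k
  have hkn' : ∀ a ∈ J, ∀ q ∈ K a, ∀ v : E, ‖chartVec (E := E) a q v‖ ≤ k' * ‖v‖ ∧
      ‖v‖ ≤ k' * ‖chartVec (E := E) a q v‖ := fun a ha q hq v =>
    ⟨(hkn a q hq v).1.trans (mul_le_mul_of_nonneg_right (hk' a ha) (norm_nonneg _)),
      (hkn a q hq v).2.trans (mul_le_mul_of_nonneg_right (hk' a ha) (norm_nonneg _))⟩
  have hPA' : ∀ a ∈ J, ∀ q ∈ K a, ∀ i v, ‖P a i q v‖ ≤ A' * ‖v‖ := fun a ha q hq i v =>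
    (hPA a q hq i v).trans (mul_le_mul_of_nonneg_right (hA' a ha) (norm_nonneg _))
  -- a time after which the contraction beats all the constants
  obtain ⟨T, hT1, hT⟩ : ∃ T : ℝ, 1 ≤ T ∧ k' * k' * C * A' * Real.exp (-lam * T) ≤ 1 / 16 := by
    have h1 : Tendsto (fun t : ℝ => k' * k' * C * A' * Real.exp (-lam * t)) atTop
        (𝓝 (k' * k' * C * A' * 0)) := by
      refine (Real.tendsto_exp_atBot.comp ?_).const_mul _
      exact tendsto_id.const_mul_atTop_of_neg (neg_lt_zero.2 h.rate_pos)
    rw [mul_zero] at h1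
    obtain ⟨T, hT, hT'⟩ := ((eventually_ge_atTop (1 : ℝ)).and
      (h1.eventually (ge_mem_nhds (by norm_num : (0 : ℝ) < 1 / 16)))).exists
    exact ⟨T, hT, hT'⟩
  let A₀ := max A' (k' * A' / m)
  have hA₀ : 1 ≤ A₀ := hA'1.trans (le_max_left _ _)
  have hη : 0 < 1 / (12 * A₀) := by positivity
  -- uniform strict differentiability
  obtain ⟨r, hr, Hr⟩ := exists_pos_forall_mem_finset (J ×ˢ J)
    (p := fun ab r => ∀ q ∈ K ab.1 ∩ ϕ T ⁻¹' K ab.2, ∀ x y : ℝ × E,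
      dist x (0, extChartAt 𝓘(ℝ, E) ab.1 q) < r → dist y (0, extChartAt 𝓘(ℝ, E) ab.1 q) < r →
      x ∈ chartFlowDomain E ϕ T ab.1 ab.2 ∧
        ‖chartFlow E ϕ T ab.1 ab.2 x - chartFlow E ϕ T ab.1 ab.2 y -
          fderiv ℝ (chartFlow E ϕ T ab.1 ab.2) (0, extChartAt 𝓘(ℝ, E) ab.1 q) (x - y)‖ ≤
            1 / (12 * A₀) * ‖x - y‖)
    (fun ab x y _ hyx hx q hq u w hu hw => hx q hq u w (hu.trans_le hyx) (hw.trans_le hyx))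
    fun ab => by
      obtain ⟨a, b⟩ := ab
      have hcpt : IsCompact (K a ∩ ϕ T ⁻¹' K b) :=
        (hK a).inter_right ((hK b).isClosed.preimage (ϕ.continuous_toFun T))
      have hci : IsCompact ((fun q : M => ((0 : ℝ), extChartAt 𝓘(ℝ, E) a q)) ''
          (K a ∩ ϕ T ⁻¹' K b)) := by
        refine hcpt.image_of_continuousOn (continuousOn_const.prodMk
          ((continuousOn_extChartAt a).mono ?_))
        rw [extChartAt_source]
        exact inter_subset_left.trans (hKa a)
      obtain ⟨r, hr, H⟩ := exists_forall_norm_sub_fderiv_le_of_isCompact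
        (isOpen_chartFlowDomain T a b) (contDiffOn_chartFlow hϕ T a b) hci (by
          rintro - ⟨q, hq, rfl⟩
          exact mem_chartFlowDomain (hKa a hq.1) (hKa b hq.2)) hη
      exact ⟨r, hr, fun q hq x y hx hy => H _ (mem_image_of_mem _ hq) x y hx hy⟩
  -- uniform continuity of the stable projections
  obtain ⟨δ, hδ, Hδ⟩ := exists_pos_forall_mem_finset J
    (p := fun b δ => ∀ q ∈ K b, ∀ q' ∈ K b, dist q q' < δ → ‖P b 1 q - P b 1 q'‖ ≤ 1 / 16)
    (fun b x y _ hyx hx q hq q' hq' hd => hx q hq q' hq' (hd.trans_le hyx)) fun b => by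
      obtain ⟨δ, hδ, H⟩ := Metric.uniformContinuousOn_iff.1
        ((hK b).uniformContinuousOn_of_continuous (hPc b 1)) (1 / 16) (by norm_num)
      refine ⟨δ, hδ, fun q hq q' hq' hd => ?_⟩
      rw [← dist_eq_norm]
      exact (H q hq q' hq' hd).le
  refine ⟨T, A₀, r, δ, fun a => P a 1, hT1, hA₀, hr, hδ, ?_⟩
  intro a ha b hb q hq hqb q' hq' hd
  obtain ⟨B, c, h1, h2, h3, h4⟩ := h.exists_chart_inverse hϕ (zero_le_one.trans hT1) (hKΛ a hq)
    (hKa a hq) (hKa b hqb) (hKΛ b hqb) (zero_le_one.trans hk'1) (zero_le_one.trans hk'1) hm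
    (hkn' a ha q hq) (hkn' b hb _ hqb) (hV _ (hKΛ b hqb)).1 (hPmem a q hq) (hPmem b _ hqb)
    (hPsum b _ hqb) (hPA' a ha q hq) (hPA' b hb _ hqb)
  refine ⟨_, B, c, fun g => ?_, fun g => ?_, fun g => ?_, fun g => ?_, fun g => ?_,
    fun x y hx hy => Hr (a, b) (Finset.mk_mem_product ha hb) q ⟨hq, hqb⟩ x y hx hy⟩
  · exact (hPA' a ha q hq 1 g).trans
      (mul_le_mul_of_nonneg_right (le_max_left _ _) (norm_nonneg _))
  · exact (h3 g).trans (mul_le_mul_of_nonneg_right (le_max_right _ _) (norm_nonneg _))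
  · exact (h2 g).trans (mul_le_mul_of_nonneg_right hT (norm_nonneg _))
  · exact (h4 g).trans (mul_le_mul_of_nonneg_right hT (norm_nonneg _))
  · have e : g - P b 1 q' g - fderiv ℝ (chartFlow E ϕ T a b) (0, extChartAt 𝓘(ℝ, E) a q)
        (c g, B g) = (P b 1 (ϕ T q) - P b 1 q') g := by
      have := h1 g
      rw [sub_eq_zero] at this
      rw [← this, sub_apply]
      abel
    rw [e]
    exact (ContinuousLinearMap.le_opNorm _ _).trans
      (mul_le_mul_of_nonneg_right (Hδ b hb _ hqb q' hq' hd) (norm_nonneg _))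

end UniformCharts

/-! ### Points that stay near an attractor for all past time -/

section Attractor

variable {M : Type*} [MetricSpace M]

/-- A point that is reached after arbitrarily long times from points close to an attractor belongs
to the attractor, since a compact neighbourhood is attracted uniformly. -/
theorem IsAttractor.exists_forall_mem_of_reached [LocallyCompactSpace M] {ϕ : Flow ℝ M} {Λ : Set M}
    (h : IsAttractor ϕ Λ) :
    ∃ ε > 0, ∀ z : M, (∀ R : ℝ, ∃ s ≥ R, ∃ w, (∃ q ∈ Λ, dist w q < ε) ∧ ϕ s w = z) → z ∈ Λ := by
  obtain ⟨L, hL, hΛL, hLb⟩ := exists_compact_between h.isCompact isOpen_interior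
    (subset_interior_iff_mem_nhdsSet.2 h.basin_mem)
  obtain ⟨ε, hε, Hε⟩ := exists_ball_subset_of_isCompact h.isCompact isOpen_interior hΛL
  refine ⟨ε, hε, fun z hz => ?_⟩
  by_contra hzΛ
  -- a neighbourhood `U` of `Λ` from which `z` cannot be reached
  have hV : ({z}ᶜ : Set M) ∈ 𝓝ˢ Λ := isOpen_compl_singleton.mem_nhdsSet.2 fun x hx hxz =>
    hzΛ (by rwa [← mem_singleton_iff.1 hxz])
  obtain ⟨U, hU, hUV⟩ := h.stable _ hV
  have hO : interior U ∈ 𝓝ˢ Λ :=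
    isOpen_interior.mem_nhdsSet.2 (subset_interior_iff_mem_nhdsSet.2 hU)
  -- uniform bound on the time needed to enter `U`
  have hunif : ∃ R : ℝ, ∀ w ∈ L, ∃ t, 0 ≤ t ∧ t ≤ R ∧ ϕ t w ∈ U := by
    refine hL.induction_on (p := fun S => ∃ R : ℝ, ∀ w ∈ S, ∃ t, 0 ≤ t ∧ t ≤ R ∧ ϕ t w ∈ U)
      ⟨0, by simp⟩ (fun S S' hSS' ⟨R, hR⟩ => ⟨R, fun w hw => hR w (hSS' hw)⟩) ?_ ?_
    · rintro S S' ⟨R, hR⟩ ⟨R', hR'⟩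
      refine ⟨max R R', fun w hw => ?_⟩
      rcases hw with hw | hw
      · obtain ⟨t, h0, h1, h2⟩ := hR w hw
        exact ⟨t, h0, h1.trans (le_max_left _ _), h2⟩
      · obtain ⟨t, h0, h1, h2⟩ := hR' w hw
        exact ⟨t, h0, h1.trans (le_max_right _ _), h2⟩
    · intro w hw
      have hwb : Tendsto (fun t : ℝ => ϕ t w) atTop (𝓝ˢ Λ) := interior_subset (hLb hw)
      obtain ⟨t, ht, ht0⟩ := ((hwb.eventually hO).and (eventually_ge_atTop 0)).exists
      refine ⟨ϕ t ⁻¹' interior U, mem_nhdsWithin_of_mem_nhds ?_, t, fun w' hw' =>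
        ⟨t, ht0, le_rfl, interior_subset hw'⟩⟩
      exact (ϕ.continuous_toFun t).continuousAt.preimage_mem_nhds (isOpen_interior.mem_nhds ht)
  obtain ⟨R, hR⟩ := hunif
  obtain ⟨s, hs, w, ⟨q, hq, hwq⟩, hsw⟩ := hz R
  obtain ⟨t, -, htR, htU⟩ := hR w (interior_subset (Hε q hq w hwq))
  have := hUV (s - t) (by linarith) htU
  rw [← ϕ.map_add, sub_add_cancel, hsw] at this
  exact this rfl

end Attractor

/-! ### Shadowing by orbits of the attractor -/

section Shadowing

/-- The weights of the shadowing problem: constant in the past, decaying in the future. -/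
noncomputable def shadowWeight (n : ℤ) : ℝ := (1 / 2) ^ n.toNat

theorem shadowWeight_pos (n : ℤ) : 0 < shadowWeight n := by unfold shadowWeight; positivity

theorem shadowWeight_le_one (n : ℤ) : shadowWeight n ≤ 1 :=
  pow_le_one₀ (by norm_num) (by norm_num)

theorem shadowWeight_succ_le (n : ℤ) : shadowWeight (n + 1) ≤ shadowWeight n :=
  pow_le_pow_of_le_one (by norm_num) (by norm_num) (by omega)

theorem shadowWeight_le_two_mul (n : ℤ) : shadowWeight n ≤ 2 * shadowWeight (n + 1) := by
  unfold shadowWeight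
  rcases le_or_gt 0 n with hn | hn
  · have : (n + 1).toNat = n.toNat + 1 := by omega
    rw [this, pow_succ]
    linarith
  · have h1 : (n + 1).toNat = 0 := by omega
    have h2 : n.toNat = 0 := by omega
    rw [h1, h2]
    norm_num

theorem shadowWeight_natCast (n : ℕ) : shadowWeight n = (1 / 2) ^ n := by
  simp [shadowWeight]

theorem shadowWeight_neg_one : shadowWeight (-1) = 1 := by
  simp [shadowWeight]

/-- The backward orbit of `x₀` followed by the forward orbit of `y`, at multiples of `T`. -/
noncomputable def splicedOrbit {M : Type*} [MetricSpace M] (ϕ : Flow ℝ M) (T : ℝ) (x₀ y : M)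
    (n : ℤ) : M :=
  if 0 ≤ n then ϕ (n * T) y else ϕ (n * T) x₀

section SplicedOrbit

variable {M : Type*} [MetricSpace M] {ϕ : Flow ℝ M} {T : ℝ} {x₀ y : M}

theorem flow_splicedOrbit {n : ℤ} (hn : n ≠ -1) :
    ϕ T (splicedOrbit ϕ T x₀ y n) = splicedOrbit ϕ T x₀ y (n + 1) := by
  unfold splicedOrbit
  have e : T + n * T = ((n + 1 : ℤ) : ℝ) * T := by push_cast; ring
  by_cases h : 0 ≤ n
  · rw [if_pos h, if_pos (by omega), ← ϕ.map_add, e]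
  · rw [if_neg h, if_neg (by omega), ← ϕ.map_add, e]

theorem flow_splicedOrbit_neg_one : ϕ T (splicedOrbit ϕ T x₀ y (-1)) = x₀ := by
  rw [splicedOrbit, if_neg (by norm_num), ← ϕ.map_add]
  have : T + ((-1 : ℤ) : ℝ) * T = 0 := by push_cast; ring
  rw [this, ϕ.map_zero_apply]

theorem splicedOrbit_natCast (n : ℕ) : splicedOrbit ϕ T x₀ y n = ϕ (n * T) y := by
  rw [splicedOrbit, if_pos (by omega), Int.cast_natCast]

end SplicedOrbit

variable {E : Type*} [NormedAddCommGroup E] [NormedSpace ℝ E] [FiniteDimensional ℝ E]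
  {M : Type*} [MetricSpace M] [ChartedSpace E M] [IsManifold 𝓘(ℝ, E) 1 M]
  [RiemannianBundle (fun x : M => TangentSpace 𝓘(ℝ, E) x)]
  [IsContinuousRiemannianBundle E (fun x : M => TangentSpace 𝓘(ℝ, E) x)] {ϕ : Flow ℝ M}
  {Λ : Set M} {Es Eu : ∀ x : M, Submodule ℝ (TangentSpace 𝓘(ℝ, E) x)} {C lam : ℝ}

/-- Shadowing with time shifts: if the forward orbit of `y` stays close to a hyperbolic set `Λ`,
there is a full orbit `z`, sampled at times `T + τ n`, that stays near `Λ` and converges to the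
orbit of `y`; the time shifts are summable in the future. The orbit is obtained by correcting the
single small jump of `splicedOrbit`. -/
theorem IsHyperbolicSplitting.exists_shadowing (h : IsHyperbolicSplitting ϕ Λ Es Eu C lam)
    (hϕ : ContMDiff (𝓘(ℝ, ℝ).prod 𝓘(ℝ, E)) 𝓘(ℝ, E) 1 (fun p : ℝ × M => ϕ p.1 p.2))
    (hΛ : IsCompact Λ) (hinv : IsInvariant ϕ Λ) :
    ∃ T : ℝ, 1 ≤ T ∧ ∀ ε > 0, ∃ δ > 0, ∀ x₀ ∈ Λ, ∀ y, dist x₀ y < δ →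
      (∀ t : ℝ, 0 ≤ t → ∃ q ∈ Λ, dist (ϕ t y) q < δ) →
      ∃ (z : ℤ → M) (τ : ℤ → ℝ), (∀ n, ϕ (T + τ n) (z n) = z (n + 1)) ∧
        (∀ n, |τ n| ≤ ε * shadowWeight n) ∧ (∀ n, ∃ q ∈ Λ, dist (z n) q < ε) ∧
        dist (z 0) y < ε ∧ Tendsto (fun n : ℕ => dist (z n) (ϕ (n * T) y)) atTop (𝓝 0) := by
  obtain ⟨J, K, δ₀, hδ₀, hK, hcover⟩ := exists_finite_chart_cover E hΛ
  have hKc := fun a => (hK a).1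
  have hKΛ := fun a => (hK a).2.1
  have hKa := fun a => (hK a).2.2
  obtain ⟨T, A, r, δ₁, P, hT, hA, hr, hδ₁, hstep⟩ :=
    h.exists_uniform_charts hϕ hΛ hinv J hKc hKΛ hKa
  obtain ⟨R, hR, hsymm⟩ := exists_forall_dist_extChartAt_symm_lt J hKc hKa
  refine ⟨T, hT, fun ε hε => ?_⟩
  obtain ⟨γ₁, hγ₁, hdist⟩ := hsymm (ε / 2) (by positivity)
  have hA0 : 0 < A := zero_lt_one.trans_le hA
  -- the size of the jump in coordinates
  obtain ⟨γ, hγ, hγr, hγR, hγγ₁, hγε⟩ : ∃ γ > 0, 12 * A * γ ≤ r / 4 ∧ 12 * A * γ < R / 2 ∧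
      12 * A * γ < γ₁ ∧ 12 * A * γ ≤ ε := by
    let s := min (min (r / 4) (R / 4)) (min (γ₁ / 2) ε)
    have hs : 0 < s := by positivity
    have hs' : 12 * A * (s / (12 * A)) = s := by field_simp
    refine ⟨s / (12 * A), by positivity, ?_, ?_, ?_, ?_⟩ <;> rw [hs']
    · exact (min_le_left _ _).trans (min_le_left _ _)
    · exact ((min_le_left _ _).trans (min_le_right _ _)).trans_lt (by linarith)
    · exact ((min_le_right _ _).trans (min_le_left _ _)).trans_lt (by linarith)
    · exact (min_le_right _ _).trans (min_le_right _ _)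
  have hγle : γ ≤ 12 * A * γ := by nlinarith
  obtain ⟨δ₂, hδ₂, hcoord⟩ := exists_forall_norm_extChartAt_sub_lt (E := E) J hKc hKa hγ
  -- the time-`T` map near `Λ`
  obtain ⟨δ₃, hδ₃, hflow⟩ := exists_forall_dist_lt_of_isCompact hΛ (f := ϕ T)
    (fun k _ => (ϕ.continuous_toFun T).continuousAt)
    (show 0 < min δ₀ δ₁ / 2 by positivity)
  let δ := min (min (δ₂ / 2) δ₃) (min (min δ₀ δ₁ / 4) (ε / 2))
  have hδ : 0 < δ := by positivity
  have hδ2 : 2 * δ ≤ δ₂ := by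
    have : δ ≤ δ₂ / 2 := (min_le_left _ _).trans (min_le_left _ _)
    linarith
  have hδ3 : δ ≤ δ₃ := (min_le_left _ _).trans (min_le_right _ _)
  have hδ01 : δ ≤ min δ₀ δ₁ / 4 := (min_le_right _ _).trans (min_le_left _ _)
  have hδε : δ ≤ ε / 2 := (min_le_right _ _).trans (min_le_right _ _)
  refine ⟨δ, hδ, fun x₀ hx₀ y hx₀y hy => ?_⟩
  let p := splicedOrbit ϕ T x₀ y
  have hq : ∀ n, ∃ q ∈ Λ, dist (p n) q < δ := by
    intro n
    by_cases hn : 0 ≤ n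
    · have : p n = ϕ (n * T) y := if_pos hn
      rw [this]
      exact hy _ (mul_nonneg (by exact_mod_cast hn) (zero_le_one.trans hT))
    · have : p n = ϕ (n * T) x₀ := if_neg hn
      exact ⟨p n, by rw [this]; exact hinv _ hx₀, by rwa [dist_self]⟩
  choose q hqΛ hpq using hq
  have hp0 : p 0 = y := by
    have := splicedOrbit_natCast (ϕ := ϕ) (T := T) (x₀ := x₀) (y := y) 0
    simpa [ϕ.map_zero_apply] using this
  have hpx₀ : ∀ n, dist (ϕ T (p n)) (p (n + 1)) < δ := by
    intro n
    by_cases hn : n = -1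
    · subst hn
      have e1 : ϕ T (p (-1)) = x₀ := flow_splicedOrbit_neg_one
      rw [e1, neg_add_cancel, hp0]
      exact hx₀y
    · have e1 : ϕ T (p n) = p (n + 1) := flow_splicedOrbit hn
      rw [e1, dist_self]
      exact hδ
  -- hence the points `q n ∈ Λ` form a pseudo-orbit, whose charts fit together
  have hjump : ∀ n, dist (ϕ T (q n)) (q (n + 1)) < min δ₀ δ₁ := by
    intro n
    have h1 := hflow (q n) (hqΛ n) (p n) ((hpq n).trans_le hδ3)
    have h2 := dist_triangle4 (ϕ T (q n)) (ϕ T (p n)) (p (n + 1)) (q (n + 1))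
    rw [dist_comm] at h1
    linarith [hpx₀ n, hpq (n + 1)]
  choose a haJ haK using fun n => hcover (q n) (hqΛ n)
  have hqK : ∀ n, q n ∈ K (a n) := fun n => haK n _ (hqΛ n) (by rwa [dist_self])
  have hqK' : ∀ n, ϕ T (q n) ∈ K (a (n + 1)) := fun n =>
    haK _ _ (hinv T (hqΛ n)) ((hjump n).trans_le (min_le_left _ _))
  choose D B c hP hc hB hDP hone hF using fun n => hstep (a n) (haJ n) (a (n + 1)) (haJ _) (q n)
    (hqK n) (hqK' n) (q (n + 1)) (hqK _) ((hjump n).trans_le (min_le_right _ _))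
  -- coordinates of the spliced orbit
  let b : ℤ → E := fun n => extChartAt 𝓘(ℝ, E) (a n) (p n)
  have hcoordp : ∀ n x, dist x (q n) < 2 * δ → x ∈ (chartAt E (a n)).source ∧
      ‖extChartAt 𝓘(ℝ, E) (a n) x - extChartAt 𝓘(ℝ, E) (a n) (q n)‖ < γ := fun n x hx =>
    hcoord (a n) (haJ n) (q n) (hqK n) x (hx.trans_le hδ2)
  have hps : ∀ n, p n ∈ (extChartAt 𝓘(ℝ, E) (a n)).source := fun n => by
    rw [extChartAt_source]
    exact (hcoordp n _ ((hpq n).trans (by linarith))).1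
  have hb : ∀ n, ‖b n - extChartAt 𝓘(ℝ, E) (a n) (q n)‖ < γ := fun n =>
    (hcoordp n _ ((hpq n).trans (by linarith))).2
  let F : ℤ → ℝ × E → E := fun n x =>
    chartFlow E ϕ T (a n) (a (n + 1)) ((0, b n) + x) - b (n + 1)
  have hnear : ∀ n (x : ℝ × E), ‖x‖ ≤ r / 4 →
      dist ((0, b n) + x) (0, extChartAt 𝓘(ℝ, E) (a n) (q n)) < r := by
    intro n x hx
    rw [dist_eq_norm]
    have e : ((0 : ℝ), b n) + x - (0, extChartAt 𝓘(ℝ, E) (a n) (q n)) =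
        (0, b n - extChartAt 𝓘(ℝ, E) (a n) (q n)) + x := by
      ext <;> simp [add_sub_right_comm]
    rw [e]
    refine (norm_add_le _ _).trans_lt ?_
    rw [Prod.norm_mk, norm_zero, max_eq_right (norm_nonneg _)]
    linarith [hb n]
  -- the only error is the jump at `n = -1`, where the weight is `1`
  have hF0 : ∀ n, ‖F n 0‖ ≤ 2 * γ * shadowWeight n := by
    intro n
    have hinvp := (extChartAt 𝓘(ℝ, E) (a n)).left_inv (hps n)
    have e : F n 0 = extChartAt 𝓘(ℝ, E) (a (n + 1)) (ϕ T (p n)) - b (n + 1) := by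
      simp only [F, chartFlow, add_zero]
      rw [hinvp]
    rw [e]
    by_cases hn : n = -1
    · subst hn
      rw [shadowWeight_neg_one, mul_one]
      have h1 : dist (ϕ T (p (-1))) (q (-1 + 1)) < 2 * δ := by
        linarith [dist_triangle (ϕ T (p (-1))) (p (-1 + 1)) (q (-1 + 1)), hpx₀ (-1),
          hpq (-1 + 1)]
      have h2 := (hcoordp _ _ h1).2
      have h3 := hb (-1 + 1)
      rw [norm_sub_rev] at h3
      have h4 := norm_sub_le_norm_sub_add_norm_sub
        (extChartAt 𝓘(ℝ, E) (a (-1 + 1)) (ϕ T (p (-1))))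
        (extChartAt 𝓘(ℝ, E) (a (-1 + 1)) (q (-1 + 1))) (b (-1 + 1))
      linarith
    · have e1 : ϕ T (p n) = p (n + 1) := flow_splicedOrbit hn
      rw [e1, sub_self, norm_zero]
      have := shadowWeight_pos n
      positivity
  obtain ⟨x, hxn, hx⟩ := exists_solution_of_approx_hyperbolic (F := F) (D := D)
    (P := fun n => P (a n) (q n)) (B := B) (c := c) (ρ := shadowWeight) (K := A) (r := r / 4)
    (η := 1 / (12 * A)) (δ := 2 * γ) shadowWeight_pos shadowWeight_le_one shadowWeight_succ_le
    shadowWeight_le_two_mul hA hP hc hB hDP hone (by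
      intro n x y hx hy
      have := (hF n _ _ (hnear n x hx) (hnear n y hy)).2
      simpa [F] using this) (by field_simp; exact le_rfl) (by positivity) hF0 (by positivity)
    (by linarith)
  have hxle : ∀ n, ‖x n‖ ≤ 12 * A * γ * shadowWeight n := fun n =>
    (hxn n).trans_eq (by ring)
  have hxle' : ∀ n, ‖x n‖ ≤ 12 * A * γ := fun n =>
    (hxle n).trans (mul_le_of_le_one_right (by positivity) (shadowWeight_le_one n))
  have hdom : ∀ n, ((0 : ℝ), b n) + x n ∈ chartFlowDomain E ϕ T (a n) (a (n + 1)) := fun n =>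
    (hF n _ _ (hnear n _ ((hxle' n).trans hγr)) (hnear n _ ((hxle' n).trans hγr))).1
  let z : ℤ → M := fun n => (extChartAt 𝓘(ℝ, E) (a n)).symm (b n + (x n).2)
  have hzp : ∀ n, p n = (extChartAt 𝓘(ℝ, E) (a n)).symm (b n) := fun n =>
    ((extChartAt 𝓘(ℝ, E) (a n)).left_inv (hps n)).symm
  have hR1 : ∀ n, ‖b n - extChartAt 𝓘(ℝ, E) (a n) (q n)‖ < R := fun n =>
    (hb n).trans (by linarith)
  have hR2 : ∀ n, ‖b n + (x n).2 - extChartAt 𝓘(ℝ, E) (a n) (q n)‖ < R := fun n => by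
    have h1 := norm_add_le (b n - extChartAt 𝓘(ℝ, E) (a n) (q n)) (x n).2
    rw [sub_add_eq_add_sub] at h1
    linarith [hb n, norm_snd_le (x n), hxle' n]
  have hsub : ∀ n, ‖b n + (x n).2 - b n‖ ≤ ‖x n‖ := fun n => by
    rw [add_sub_cancel_left]
    exact norm_snd_le _
  have hzpd : ∀ n, dist (z n) (p n) < ε / 2 := fun n => by
    rw [hzp n]
    exact hdist (a n) (haJ n) (q n) (hqK n) _ _ (hR2 n) (hR1 n)
      ((hsub n).trans_lt ((hxle' n).trans_lt hγγ₁))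
  refine ⟨z, fun n => (x n).1, fun n => ?_, fun n => ?_, fun n => ⟨q n, hqΛ n, ?_⟩, ?_, ?_⟩
  · have h1 := hx n
    simp only [F, chartFlow, Prod.fst_add, Prod.snd_add, zero_add] at h1
    rw [sub_eq_iff_eq_add'] at h1
    have h2 := (hdom n).2
    simp only [mem_preimage, Prod.fst_add, Prod.snd_add, zero_add] at h2
    rw [← extChartAt_source 𝓘(ℝ, E)] at h2
    have h3 := (extChartAt 𝓘(ℝ, E) (a (n + 1))).left_inv h2
    rw [h1] at h3
    exact h3.symm
  · exact (norm_fst_le (x n)).trans ((hxle n).trans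
      (mul_le_mul_of_nonneg_right hγε (shadowWeight_pos n).le))
  · linarith [dist_triangle (z n) (p n) (q n), hzpd n, hpq n]
  · rw [← hp0]
    linarith [hzpd 0]
  · rw [Metric.tendsto_atTop]
    intro ε' hε'
    obtain ⟨γ₂, hγ₂, H⟩ := hsymm ε' hε'
    have h1 : Tendsto (fun n : ℕ => 12 * A * γ * (1 / 2 : ℝ) ^ n) atTop (𝓝 (12 * A * γ * 0)) :=
      (tendsto_pow_atTop_nhds_zero_of_lt_one (by norm_num) (by norm_num)).const_mul _
    rw [mul_zero] at h1
    obtain ⟨N, hN⟩ := eventually_atTop.1 (h1.eventually (gt_mem_nhds hγ₂))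
    refine ⟨N, fun n hn => ?_⟩
    rw [dist_zero_right, Real.norm_of_nonneg dist_nonneg,
      ← splicedOrbit_natCast (ϕ := ϕ) (T := T) (x₀ := x₀) (y := y) n]
    have e : splicedOrbit ϕ T x₀ y n = (extChartAt 𝓘(ℝ, E) (a n)).symm (b n) := hzp n
    rw [e]
    refine H (a n) (haJ n) (q n) (hqK n) _ _ (hR2 n) (hR1 n) ((hsub n).trans_lt ?_)
    have := hxle n
    rw [shadowWeight_natCast] at this
    exact this.trans_lt (hN n hn)

end Shadowing

/-! ### Asymptotic phase -/

section StableShadowing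

variable {M : Type*} [MetricSpace M] {ϕ : Flow ℝ M}

/-- Convergence of two orbits along multiples of `T` implies convergence in continuous time. -/
theorem mem_stableLeaf_of_tendsto_natMul {Λ : Set M} (hΛ : IsCompact Λ) (hinv : IsInvariant ϕ Λ)
    {T : ℝ} (hT : 0 < T) {x y : M} (hx : x ∈ Λ)
    (h : Tendsto (fun n : ℕ => dist (ϕ (n * T) x) (ϕ (n * T) y)) atTop (𝓝 0)) :
    y ∈ stableLeaf ϕ x := by
  change Tendsto (fun t : ℝ => dist (ϕ t x) (ϕ t y)) atTop (𝓝 0)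
  rw [Metric.tendsto_atTop]
  intro ε hε
  obtain ⟨δ, hδ, H⟩ := exists_forall_dist_lt_of_isCompact
    (isCompact_Icc (a := 0) (b := T) |>.prod hΛ)
    (f := fun p : ℝ × M => ϕ p.1 p.2) (fun k _ => ϕ.cont'.continuousAt) hε
  obtain ⟨N, hN⟩ := eventually_atTop.1 (h.eventually (gt_mem_nhds hδ))
  refine ⟨N * T, fun t ht => ?_⟩
  have ht0 : 0 ≤ t := le_trans (by positivity) ht
  have hfl := Nat.floor_le (div_nonneg ht0 hT.le)
  have hfl' := Nat.lt_floor_add_one (t / T)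
  rw [le_div_iff₀ hT] at hfl
  rw [div_lt_iff₀ hT] at hfl'
  have hNn : N ≤ ⌊t / T⌋₊ := Nat.le_floor (by rwa [le_div_iff₀ hT])
  have hsplit : ∀ w, ϕ t w = ϕ (t - ⌊t / T⌋₊ * T) (ϕ (⌊t / T⌋₊ * T) w) := fun w => by
    rw [← ϕ.map_add, sub_add_cancel]
  rw [dist_zero_right, Real.norm_of_nonneg dist_nonneg, hsplit x, hsplit y, dist_comm]
  refine H (t - ⌊t / T⌋₊ * T, ϕ (⌊t / T⌋₊ * T) x) ⟨⟨by linarith, by linarith⟩, hinv _ hx⟩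
    (t - ⌊t / T⌋₊ * T, ϕ (⌊t / T⌋₊ * T) y) ?_
  rw [Prod.dist_eq, dist_self, max_eq_right dist_nonneg, dist_comm]
  exact hN _ hNn

theorem flow_sum_eq {T : ℝ} {z : ℤ → M} {τ : ℤ → ℝ} (hz : ∀ n, ϕ (T + τ n) (z n) = z (n + 1))
    (n : ℕ) : z n = ϕ (n * T + ∑ k ∈ Finset.range n, τ k) (z 0) := by
  induction n with
  | zero => simp [ϕ.map_zero_apply]
  | succ n ih =>
    have := hz n
    rw [ih, ← ϕ.map_add] at this
    push_cast
    rw [← this, Finset.sum_range_succ]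
    congr 1
    ring

/-- Going back `n` steps takes a time of at least `n / 2`. -/
theorem exists_flow_eq_of_backward {T : ℝ} (hT : 1 ≤ T) {z : ℤ → M} {τ : ℤ → ℝ}
    (hτ : ∀ n, |τ n| ≤ 1 / 2) (hz : ∀ n, ϕ (T + τ n) (z n) = z (n + 1)) (n : ℕ) :
    ∃ s : ℝ, (n : ℝ) / 2 ≤ s ∧ ϕ s (z (-n)) = z 0 := by
  induction n with
  | zero => exact ⟨0, by simp, by simp [ϕ.map_zero_apply]⟩
  | succ n ih =>
    obtain ⟨s, hs, hsz⟩ := ih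
    refine ⟨s + (T + τ (-(n + 1 : ℕ))), ?_, ?_⟩
    · have := (abs_le.1 (hτ (-(n + 1 : ℕ)))).1
      push_cast at this ⊢
      linarith
    · rw [ϕ.map_add, hz]
      have : -((n + 1 : ℕ) : ℤ) + 1 = -n := by push_cast; ring
      rw [this, hsz]

variable {E : Type*} [NormedAddCommGroup E] [NormedSpace ℝ E] [FiniteDimensional ℝ E]
  [ChartedSpace E M] [IsManifold 𝓘(ℝ, E) 1 M]
  [RiemannianBundle (fun x : M => TangentSpace 𝓘(ℝ, E) x)]
  [IsContinuousRiemannianBundle E (fun x : M => TangentSpace 𝓘(ℝ, E) x)]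

/-- In a neighbourhood of a hyperbolic attractor every point lies on the stable leaf of a nearby
point of the attractor. The shadowing orbit lies in the attractor because its whole past stays
close to it; the accumulated time shift is absorbed by moving along the orbit. -/
theorem hasStableShadowing {Λ : Set M}
    (hϕ : ContMDiff (𝓘(ℝ, ℝ).prod 𝓘(ℝ, E)) 𝓘(ℝ, E) 1 (fun p : ℝ × M => ϕ p.1 p.2))
    (hΛ : IsAttractor ϕ Λ) (hhyp : IsUniformlyHyperbolic (E := E) ϕ Λ) :
    HasStableShadowing ϕ Λ := by
  intro ε hε
  obtain ⟨Es, Eu, C, lam, hC, hlam, hsp⟩ := hhyp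
  have h : IsHyperbolicSplitting ϕ Λ Es Eu C lam :=
    ⟨hC, hlam, fun x hx => (hsp x hx).1, fun x hx => (hsp x hx).2.1,
      fun x hx => (hsp x hx).2.2.1, fun x hx => (hsp x hx).2.2.2.1,
      fun x hx => (hsp x hx).2.2.2.2.1, fun x hx => (hsp x hx).2.2.2.2.2⟩
  have hc := hΛ.isCompact
  have hinv := hΛ.isInvariant
  have : LocallyCompactSpace M := ChartedSpace.locallyCompactSpace E M
  obtain ⟨ε₀, hε₀, hreach⟩ := hΛ.exists_forall_mem_of_reached
  obtain ⟨T, hT, hshadow⟩ := h.exists_shadowing hϕ hc hinv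
  -- a short time moves the points of `Λ` only a little
  obtain ⟨κ, hκ, hshort⟩ := exists_forall_dist_lt_of_isCompact
    (isCompact_singleton (x := (0 : ℝ)) |>.prod hc)
    (f := fun p : ℝ × M => ϕ p.1 p.2) (fun k _ => ϕ.cont'.continuousAt) (half_pos hε)
  let ε₁ := min (min (1 / 2) ε₀) (min (ε / 2) (κ / 4))
  have hε₁ : 0 < ε₁ := by positivity
  have h1 : ε₁ ≤ 1 / 2 := (min_le_left _ _).trans (min_le_left _ _)
  have h2 : ε₁ ≤ ε₀ := (min_le_left _ _).trans (min_le_right _ _)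
  have h3 : ε₁ ≤ ε / 2 := (min_le_right _ _).trans (min_le_left _ _)
  have h4 : ε₁ ≤ κ / 4 := (min_le_right _ _).trans (min_le_right _ _)
  obtain ⟨δ, hδ, H⟩ := hshadow ε₁ hε₁
  obtain ⟨U, hU, hUV⟩ := hΛ.stable (Metric.thickening δ Λ)
    (Metric.isOpen_thickening.mem_nhdsSet.2 (Metric.self_subset_thickening hδ Λ))
  refine ⟨U, hU, fun y hy => ?_⟩
  have hnear : ∀ t : ℝ, 0 ≤ t → ∃ q ∈ Λ, dist (ϕ t y) q < δ := fun t ht =>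
    Metric.mem_thickening_iff.1 (hUV t ht hy)
  obtain ⟨x₀, hx₀, hd₀⟩ := hnear 0 le_rfl
  rw [ϕ.map_zero_apply, dist_comm] at hd₀
  obtain ⟨z, τ, hz, hτ, hzΛ, hz0, hlim⟩ := H x₀ hx₀ y hd₀ hnear
  -- the whole past of `z 0` stays close to the attractor
  have hz0Λ : z 0 ∈ Λ := by
    refine hreach _ fun R => ?_
    have hτ' : ∀ n, |τ n| ≤ 1 / 2 := fun n => (hτ n).trans
      ((mul_le_of_le_one_right hε₁.le (shadowWeight_le_one n)).trans h1)
    obtain ⟨n, hn⟩ := exists_nat_ge (2 * R)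
    obtain ⟨s, hs, hsz⟩ := exists_flow_eq_of_backward hT hτ' hz n
    obtain ⟨q, hq, hqd⟩ := hzΛ (-n)
    exact ⟨s, by linarith, z (-n), ⟨q, hq, hqd.trans_le h2⟩, hsz⟩
  -- the total time shift
  have hgeo : HasSum (fun n : ℕ => ε₁ * (1 / 2 : ℝ) ^ n) (ε₁ * 2) := by
    have := (hasSum_geometric_of_lt_one (r := (1 / 2 : ℝ)) (by norm_num) (by norm_num)).mul_left ε₁
    norm_num at this ⊢
    exact this
  have hτn : ∀ n : ℕ, ‖τ n‖ ≤ ε₁ * (1 / 2 : ℝ) ^ n := fun n => by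
    rw [← shadowWeight_natCast]
    exact hτ n
  have hsum : Summable (fun n : ℕ => τ n) := Summable.of_norm_bounded hgeo.summable hτn
  let s := ∑' n : ℕ, τ n
  have hs : |s| < κ := by
    have : ‖s‖ ≤ ε₁ * 2 := tsum_of_norm_bounded hgeo hτn
    rw [Real.norm_eq_abs] at this
    linarith
  have hσ := hsum.hasSum.tendsto_sum_nat
  refine ⟨ϕ s (z 0), hinv _ hz0Λ, ?_, ?_⟩
  · have := hshort (0, z 0) ⟨rfl, hz0Λ⟩ (s, z 0) (by
      rw [Prod.dist_eq, dist_self, max_eq_left dist_nonneg, dist_zero_right]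
      exact hs)
    simp only [ϕ.map_zero_apply] at this
    linarith [dist_triangle (ϕ s (z 0)) (z 0) y]
  · refine mem_stableLeaf_of_tendsto_natMul hc hinv (zero_lt_one.trans_le hT) (hinv _ hz0Λ) ?_
    have hphase : Tendsto (fun n : ℕ => dist (z n) (ϕ (n * T) (ϕ s (z 0)))) atTop (𝓝 0) := by
      rw [Metric.tendsto_atTop]
      intro ε' hε'
      obtain ⟨κ', hκ', hclose⟩ := exists_forall_dist_lt_of_isCompact
        (isCompact_singleton (x := s) |>.prod hc)
        (f := fun p : ℝ × M => ϕ p.1 p.2) (fun k _ => ϕ.cont'.continuousAt) hε'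
      obtain ⟨N, hN⟩ := Metric.tendsto_atTop.1 hσ κ' hκ'
      refine ⟨N, fun n hn => ?_⟩
      rw [dist_zero_right, Real.norm_of_nonneg dist_nonneg, flow_sum_eq hz n, ← ϕ.map_add,
        add_comm _ (∑ k ∈ _, _), add_comm _ s, ϕ.map_add, ϕ.map_add]
      refine hclose (s, ϕ (n * T) (z 0)) ⟨rfl, hinv _ hz0Λ⟩
        (∑ k ∈ Finset.range n, τ k, ϕ (n * T) (z 0)) ?_
      rw [Prod.dist_eq, dist_self, max_eq_left dist_nonneg]
      exact hN n hn
    have hadd := hphase.add hlim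
    rw [add_zero] at hadd
    refine squeeze_zero (fun _ => dist_nonneg) (fun n => ?_) hadd
    exact dist_triangle_left _ _ _

end StableShadowing

end KoopmanFlow

theorem mainTheorem1
    {E : Type*} [NormedAddCommGroup E] [NormedSpace ℝ E] [FiniteDimensional ℝ E]
    {M : Type*} [MetricSpace M] [ChartedSpace E M] [IsManifold 𝓘(ℝ, E) 1 M]
    [RiemannianBundle (fun x : M => TangentSpace 𝓘(ℝ, E) x)]
    [IsContinuousRiemannianBundle E (fun x : M => TangentSpace 𝓘(ℝ, E) x)]
    (ϕ : Flow ℝ M)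
    (hϕ : ContMDiff (𝓘(ℝ, ℝ).prod 𝓘(ℝ, E)) 𝓘(ℝ, E) 1 (fun p : ℝ × M => ϕ p.1 p.2))
    (X Λ : Set M) (hX : IsCompact X) (hXinv : IsForwardInvariant ϕ X)
    (hΛ : KoopmanFlow.IsAttractor ϕ Λ)
    (hhyp : KoopmanFlow.IsUniformlyHyperbolic (E := E) ϕ Λ)
    (hΛX : Λ ⊆ X) (hbasin : X ⊆ KoopmanFlow.basin ϕ Λ)
    (t : ℝ) (ht : 0 < t) :
    -- the stable leaves of the points of `Λ` cover `X`
    (∀ y ∈ X, ∃ x ∈ Λ, y ∈ KoopmanFlow.stableLeaf ϕ x) ∧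
    -- eigenfunctions on `Λ` extend along stable leaves to eigenfunctions on `X`
    (∀ (ζ : ℂ) (ψΛ : C(Λ, ℂ)),
      Module.End.HasEigenvector
        (KoopmanFlow.koopman ϕ hΛ.isInvariant.isForwardInvariant t ht.le).toLinearMap ζ ψΛ →
      ∃ ψX : C(X, ℂ),
        (∀ (x : Λ) (y : X), (y : M) ∈ KoopmanFlow.stableLeaf ϕ (x : M) → ψX y = ψΛ x) ∧
        Module.End.HasEigenvector (KoopmanFlow.koopman ϕ hXinv t ht.le).toLinearMap ζ ψX) ∧
    -- the spectrum on `C(Λ)` is contained in the spectrum on `C(X)`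
    spectrum ℂ (KoopmanFlow.koopman ϕ hΛ.isInvariant.isForwardInvariant t ht.le) ⊆
      spectrum ℂ (KoopmanFlow.koopman ϕ hXinv t ht.le) := by
  have hshadow := KoopmanFlow.hasStableShadowing hϕ hΛ hhyp
  have hext := fun (ζ : ℂ) (ψ : C(Λ, ℂ)) h => KoopmanFlow.exists_eigenvector_extension
    hΛ.isInvariant hshadow hΛ.isCompact hXinv hΛX hbasin ht (ζ := ζ) (ψ := ψ) h
  exact ⟨fun y hy => hshadow.exists_mem_stableLeaf hΛ.isInvariant (hbasin hy), hext,
    KoopmanFlow.spectrum_koopman_subset hΛ.isInvariant ht.le hΛ.isCompact hX hXinv hΛX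
      fun ζ ψ h => (hext ζ ψ h).imp fun _ h' => h'.2⟩
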